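/- Let $k$ be a complete ultrametric field (the absolute value may be trivial), let $n\ge 0$, and view $(\mathbb{R}_+^\times)^n$ as a multiplicative group, with $\mathbf r^I=\prod_i r_i^{I_i}$ for $I\in\mathbb{Z}^n$. A $\mathbb{Z}$-polytope is a compact subset of $(\mathbb{R}_+^\times)^n$ of the form $\{\mathbf t:\bigvee_{i}\bigwedge_{j}\varphi_{i,j}(\mathbf t)\le 1\}$ with finitely many maps $\varphi_{i,j}:\mathbf t\mapsto r\,\mathbf t^{a}$, $r>0$, $a\in\mathbb{Z}^n$. A subset $U\subseteq(\mathbb{R}_+^\times)^n$ is piecewise $\mathbb{Z}$-linear if there is a family of $\mathbb{Z}$-polytopes contained in $U$ such that every $y\in U$ has a neighbourhood in $U$ which is a union of finitely many members of the family, each containing $y$. Let $U$ be a nonempty connected piecewise $\mathbb{Z}$-linear subset, let $$\mathbb{D}_U=\{x\in\mathbb{G}_{m,k}^{n,\mathrm{an}} : (|T_1(x)|,\dots,|T_n(x)|)\in U\}$$ be the associated lace (a $k$-analytic space in the sense of Berkovich), and let $\mathcal{A}_U$ be the algebra of analytic functions on $\mathbb{D}_U$, that is, of the series $\sum_{I\in\mathbb{Z}^n}a_I\mathbf{T}^I$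 with $a_I\in k$ and $|a_I|\mathbf r^I\to 0$ as $|I|\to\infty$ for every $\mathbf r\in U$. A function $f=\sum a_I\mathbf T^I\in\mathcal{A}_U$ has a strictly dominant monomial of multidegree $I$ if $|a_I|\mathbf r^I>|a_J|\mathbf r^J$ for all $\mathbf r\in U$ and all $J\ne I$. A family $(f_1,\dots,f_n)$ in $\mathcal{A}_U$ is a coordinate system on $\mathbb{D}_U$ if it induces an isomorphism of $k$-analytic spaces from $\mathbb{D}_U$ onto $\mathbb{D}_V$ for some nonempty connected piecewise $\mathbb{Z}$-linear subset $V\subseteq(\mathbb{R}_+^\times)^n$. Let $\mathcal{A}_U^{\circ\circ}$ be the set of topologically nilpotent elements of $\mathcal{A}_U$, the topology being defined by the norms $\|f\|_{\mathbf r}=\max_I|a_I|\mathbf r^I$, $\mathbf r\in U$. Then: 1. A family $(f_1,\dots,f_n)$ in $\mathcal{A}_U$ is a coordinate system on $\mathbb{D}_U$ if and only if each $f_i$ has a strictly dominant monomial, of some multidegree $I_i\in\mathbb{Z}^n$, and the matrix with rows $I_1,\dots,I_n$ belongs to $\mathrm{GL}_n(\mathbb{Z})$. 2. The group $\mathcal{L}(\mathbb{D}_U)=\mathcal{A}_U^\times/k^\times(1+\mathcal{A}_U^{\circ\circ})$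 is free abelian of rank $n$. 3. A family $(f_1,\dots,f_n)$ in $\mathcal{A}_U$ is a coordinate system on $\mathbb{D}_U$ if and only if the $f_i$ are invertible in $\mathcal{A}_U$ and their classes form a $\mathbb{Z}$-basis of $\mathcal{L}(\mathbb{D}_U)$. -/

import Mathlib

open Filter Topology
open scoped NNReal

noncomputable section

namespace Dentelle

/-! ### Piecewise `ℤ`-linear subsets of `(ℝ₊^×)ⁿ` -/

/-- The multiplicative group `ℝ₊^×` of positive real numbers, with its usual topology. -/
abbrev PosReal : Type := {x : ℝ // 0 < x}

/-- The monomial `r^I = ∏ᵢ rᵢ^{Iᵢ}`. -/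
def mon {n : ℕ} (r : Fin n → PosReal) (I : Fin n → ℤ) : PosReal := ∏ i, r i ^ I i

/-- Members of `Aff_ℤ((ℝ₊^×)ⁿ)`: maps `t ↦ r ∏ᵢ tᵢ^{aᵢ}` with `r > 0` and `aᵢ ∈ ℤ`. -/
def IsZAffine {n : ℕ} (φ : (Fin n → PosReal) → PosReal) : Prop :=
  ∃ (r : PosReal) (a : Fin n → ℤ), ∀ t, φ t = r * mon t a

/-- A `ℤ`-polytope: a compact set cut out by a condition `⋁ᵢ ⋀ⱼ φᵢⱼ ≤ 1`. -/
def IsZPolytope {n : ℕ} (P : Set (Fin n → PosReal)) : Prop :=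
  IsCompact P ∧ ∃ (p q : ℕ) (φ : Fin p → Fin q → (Fin n → PosReal) → PosReal),
    (∀ i j, IsZAffine (φ i j)) ∧ P = {t | ∃ i, ∀ j, φ i j t ≤ 1}

/-- `𝒮` is a `G`-covering of `Y`: its members are subsets of `Y`, and every `y ∈ Y` has a
neighbourhood in `Y` that is a finite union of members of `𝒮` all of which contain `y`. -/
def IsGCovering {X : Type*} [TopologicalSpace X] (𝒮 : Set (Set X)) (Y : Set X) : Prop :=
  (∀ P ∈ 𝒮, P ⊆ Y) ∧
    ∀ y ∈ Y, ∃ F : Set (Set X), F.Finite ∧ F ⊆ 𝒮 ∧ (∀ P ∈ F, y ∈ P) ∧ ⋃₀ F ∈ 𝓝[Y] y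

/-- Piecewise `ℤ`-linear subsets of `(ℝ₊^×)ⁿ`. -/
def IsPiecewiseZLinear {n : ℕ} (U : Set (Fin n → PosReal)) : Prop :=
  ∃ 𝒮 : Set (Set (Fin n → PosReal)), (∀ P ∈ 𝒮, IsZPolytope P) ∧ IsGCovering 𝒮 U

/-- The types of `n`-dimensional laces: nonempty connected piecewise `ℤ`-linear subsets `U` of
`(ℝ₊^×)ⁿ`. (`IsConnected` includes nonemptiness.) -/
structure LaceType (n : ℕ) where
  carrier : Set (Fin n → PosReal)
  isPiecewiseZLinear : IsPiecewiseZLinear carrier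
  isConnected : IsConnected carrier

lemma mon_add {n : ℕ} (r : Fin n → PosReal) (I J : Fin n → ℤ) :
    mon r (I + J) = mon r I * mon r J := by
  simp [mon, zpow_add, Finset.prod_mul_distrib]

/-! ### The analytic torus and the spaces `D_U` -/

section Points

variable (k : Type*) [NormedField k] (n : ℕ)

/-- The algebra `k[T₁^{±1}, …, Tₙ^{±1}]` of Laurent polynomials. -/
abbrev LaurentPoly : Type _ := AddMonoidAlgebra k (Fin n → ℤ)

/-- The points of the Berkovich torus `𝔾_m^{n,an}` over `k`: multiplicative (ultrametric)
seminorms on `k[T₁^{±1}, …, Tₙ^{±1}]` that extend the absolute value of `k`. -/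
structure TorusPoint where
  val : Valuation (LaurentPoly k n) ℝ≥0
  val_const : ∀ c : k, val (AddMonoidAlgebra.single 0 c) = ‖c‖₊

/-- The topology of the Berkovich torus: the coarsest one for which all the maps `x ↦ |p(x)|`,
`p` a Laurent polynomial, are continuous. -/
instance : TopologicalSpace (TorusPoint k n) :=
  TopologicalSpace.induced (fun x (p : LaurentPoly k n) => x.val p) inferInstance

variable {k n}

/-- The monomial `T^I`. -/
def monomialT (I : Fin n → ℤ) : LaurentPoly k n := AddMonoidAlgebra.single I 1

lemma TorusPoint.val_monomialT_pos (x : TorusPoint k n) (I : Fin n → ℤ) :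
    0 < x.val (monomialT I) := by
  rw [pos_iff_ne_zero]
  intro h
  have h1 : (monomialT I : LaurentPoly k n) * monomialT (-I) = 1 := by
    simp [monomialT, AddMonoidAlgebra.single_mul_single, AddMonoidAlgebra.one_def]
  have h2 := congrArg x.val h1
  simp [h] at h2

/-- The polyradius `(|T₁(x)|, …, |Tₙ(x)|)` of a point. -/
def TorusPoint.radius (x : TorusPoint k n) (i : Fin n) : PosReal :=
  ⟨(x.val (monomialT (Pi.single i 1)) : ℝ), NNReal.coe_pos.2 (x.val_monomialT_pos _)⟩

lemma TorusPoint.val_monomialT (x : TorusPoint k n) (I : Fin n → ℤ) :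
    (x.val (monomialT I) : ℝ) = mon x.radius I := by
  let h : (Fin n → ℤ) →+ Additive PosReal :=
    AddMonoidHom.mk' (fun I => Additive.ofMul
      (⟨(x.val (monomialT I) : ℝ), NNReal.coe_pos.2 (x.val_monomialT_pos I)⟩ : PosReal)) <| by
        intro I J
        rw [← ofMul_mul]
        congr 1
        apply Subtype.ext
        rw [Positive.val_mul, ← NNReal.coe_mul, ← map_mul]
        simp [monomialT, AddMonoidAlgebra.single_mul_single]
  have key : h I = Additive.ofMul (mon x.radius I) := by
    conv_lhs => rw [← Finset.univ_sum_single I, map_sum]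
    rw [mon, ofMul_prod]
    refine Finset.sum_congr rfl fun i _ => ?_
    have : (Pi.single i (I i) : Fin n → ℤ) = I i • Pi.single i 1 := by
      rw [← Pi.single_smul]; simp
    rw [this, map_zsmul]
    rfl
  exact congrArg (fun z : Additive PosReal => ((z.toMul : PosReal) : ℝ)) key

lemma TorusPoint.val_single (x : TorusPoint k n) (I : Fin n → ℤ) (c : k) :
    (x.val (AddMonoidAlgebra.single I c) : ℝ) = ‖c‖ * mon x.radius I := by
  have : (AddMonoidAlgebra.single I c : LaurentPoly k n) =
      AddMonoidAlgebra.single 0 c * monomialT I := by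
    simp [monomialT, AddMonoidAlgebra.single_mul_single]
  rw [this, map_mul, NNReal.coe_mul, x.val_const, x.val_monomialT, coe_nnnorm]

variable (k) in
/-- The space `D_U = {x ∈ 𝔾_m^{n,an} : (|T₁(x)|, …, |Tₙ(x)|) ∈ U}`. -/
def domain (U : LaceType n) : Set (TorusPoint k n) := {x | x.radius ∈ U.carrier}

end Points

/-! ### The algebra `A_U` of analytic functions on `D_U` -/

section Functions

variable (k : Type*) [NormedField k] {n : ℕ}

/-- The families `(a_I)` with `|a_I| r^I → 0` as `|I| → ∞`, for every `r ∈ U`. -/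
def coeffSubmodule (U : LaceType n) : Submodule k ((Fin n → ℤ) → k) where
  carrier := {a | ∀ r ∈ U.carrier,
    Tendsto (fun I => ‖a I‖ * (mon r I : ℝ)) cofinite (𝓝 0)}
  zero_mem' := by intro r _; simpa using tendsto_const_nhds
  add_mem' := by
    intro a b ha hb r hr
    refine squeeze_zero (fun I => by have := (mon r I).2; positivity) (fun I => ?_)
      (by simpa using (ha r hr).add (hb r hr))
    rw [← add_mul]
    exact mul_le_mul_of_nonneg_right (norm_add_le _ _) (mon r I).2.le
  smul_mem' := by
    intro c a ha r hr
    simpa [mul_assoc] using (ha r hr).const_mul ‖c‖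

/-- The algebra `A_U` of analytic functions on `D_U`: the Laurent series `∑_I a_I T^I` with
`|a_I| r^I → 0` as `|I| → ∞`, for every `r ∈ U`. -/
def LaceFun (U : LaceType n) : Type _ := coeffSubmodule k U

variable {k}
variable {U : LaceType n}

instance : AddCommGroup (LaceFun k U) := inferInstanceAs (AddCommGroup (coeffSubmodule k U))
instance : Module k (LaceFun k U) := inferInstanceAs (Module k (coeffSubmodule k U))

/-- The coefficient `a_I` of `f = ∑_I a_I T^I`. -/
def LaceFun.coeff (f : LaceFun k U) (I : Fin n → ℤ) : k := f.1 I

namespace LaceFun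

@[ext] lemma ext {f g : LaceFun k U} (h : ∀ I, f.coeff I = g.coeff I) : f = g :=
  Subtype.ext (funext h)

@[simp] lemma coeff_add (f g : LaceFun k U) (I) : (f + g).coeff I = f.coeff I + g.coeff I := rfl
@[simp] lemma coeff_zero (I) : (0 : LaceFun k U).coeff I = 0 := rfl
@[simp] lemma coeff_smul (c : k) (f : LaceFun k U) (I) : (c • f).coeff I = c * f.coeff I := rfl

lemma tendsto (f : LaceFun k U) {r} (hr : r ∈ U.carrier) :
    Tendsto (fun I => ‖f.coeff I‖ * (mon r I : ℝ)) cofinite (𝓝 0) := f.2 r hr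

/-- The monomial `c T^I` as an element of `A_U`. -/
def single (I : Fin n → ℤ) (c : k) : LaceFun k U :=
  ⟨Pi.single I c, fun r _ => by
    refine tendsto_const_nhds.congr' ?_
    filter_upwards [(Set.finite_singleton I).compl_mem_cofinite] with J hJ
    simp [Pi.single_eq_of_ne (show J ≠ I from hJ)]⟩

@[simp] lemma coeff_single_same (I : Fin n → ℤ) (c : k) :
    (single I c : LaceFun k U).coeff I = c := by simp [single, coeff]

lemma coeff_single_ne {I J : Fin n → ℤ} (h : J ≠ I) (c : k) :
    (single I c : LaceFun k U).coeff J = 0 := by simp [single, coeff, h]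

instance : One (LaceFun k U) := ⟨single 0 1⟩

lemma one_def : (1 : LaceFun k U) = single 0 1 := rfl

lemma tendsto_pair (f g : LaceFun k U) {r} (hr : r ∈ U.carrier) :
    Tendsto (fun p : (Fin n → ℤ) × (Fin n → ℤ) =>
      ‖f.coeff p.1 * g.coeff p.2‖ * (mon r (p.1 + p.2) : ℝ)) cofinite (𝓝 0) := by
  refine (tendsto_mul_cofinite_nhds_zero (f.tendsto hr) (g.tendsto hr)).congr fun p => ?_
  rw [mon_add, norm_mul, Positive.val_mul]; ring

variable [IsUltrametricDist k]

/-- The product of Laurent series: `(fg)_I = ∑_J f_J g_{I-J}`. -/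
instance : Mul (LaceFun k U) where
  mul f g := ⟨fun I => ∑' J, f.coeff J * g.coeff (I - J), fun r hr => by
    have h := tendsto_pair f g hr
    rw [Metric.tendsto_nhds] at h ⊢
    intro ε hε
    have hfin := (h (ε / 2) (half_pos hε))
    rw [Filter.eventually_cofinite] at hfin ⊢
    refine (hfin.image fun p => p.1 + p.2).subset fun I hI => ?_
    by_contra hcon
    apply hI
    have hb : ∀ J, ‖f.coeff J * g.coeff (I - J)‖ ≤ ε / 2 / (mon r I : ℝ) := by
      intro J
      rw [le_div_iff₀ (mon r I).2]
      by_contra hJ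
      refine hcon ⟨(J, I - J), ?_, by simp⟩
      simp only [Set.mem_ofPred_eq, Real.dist_eq, sub_zero, not_lt, add_sub_cancel]
      exact (not_le.1 hJ).le.trans (le_abs_self _)
    have := IsUltrametricDist.norm_tsum_le_of_forall_le_of_nonneg
      (div_nonneg (half_pos hε).le (mon r I).2.le) hb
    rw [le_div_iff₀ (mon r I).2] at this
    have hnn : 0 ≤ ‖∑' J, f.coeff J * g.coeff (I - J)‖ * (mon r I : ℝ) :=
      mul_nonneg (norm_nonneg _) (mon r I).2.le
    rw [Real.dist_eq, sub_zero, abs_of_nonneg hnn]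
    linarith⟩

lemma coeff_mul (f g : LaceFun k U) (I) :
    (f * g).coeff I = ∑' J, f.coeff J * g.coeff (I - J) := rfl

protected lemma mul_comm' (f g : LaceFun k U) : f * g = g * f := by
  ext I
  rw [coeff_mul, coeff_mul, ← (Equiv.subLeft I).tsum_eq]
  exact tsum_congr fun J => by simp [mul_comm]

protected lemma one_mul' (f : LaceFun k U) : 1 * f = f := by
  ext I
  rw [coeff_mul, tsum_eq_single 0]
  · simp [one_def]
  · intro J hJ; simp [one_def, coeff_single_ne hJ]

variable [CompleteSpace k]

/-- Summability of the Cauchy product, coefficient by coefficient. -/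
lemma summable_conv (f g : LaceFun k U) (I : Fin n → ℤ) :
    Summable fun J => f.coeff J * g.coeff (I - J) := by
  apply NonarchimedeanAddGroup.summable_of_tendsto_cofinite_zero
  obtain ⟨r, hr⟩ := U.isConnected.nonempty
  have hinj : Function.Injective (fun J : Fin n → ℤ => (J, I - J)) :=
    fun a b h => (Prod.ext_iff.1 h).1
  have h := ((tendsto_pair f g hr).comp hinj.tendsto_cofinite).mul_const ((mon r I : ℝ)⁻¹)
  rw [zero_mul] at h
  rw [tendsto_zero_iff_norm_tendsto_zero]
  refine h.congr fun J => ?_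
  have := (mon r I).2.ne'
  simp [this]

protected lemma left_distrib' (f g h : LaceFun k U) : f * (g + h) = f * g + f * h := by
  ext I
  rw [coeff_add, coeff_mul, coeff_mul, coeff_mul,
    ← (summable_conv f g I).tsum_add (summable_conv f h I)]
  exact tsum_congr fun J => by simp [mul_add]

protected lemma mul_assoc' (f g h : LaceFun k U) : f * g * h = f * (g * h) := by
  ext I
  have hs : Summable fun p : (Fin n → ℤ) × (Fin n → ℤ) =>
      f.coeff p.1 * (g.coeff p.2 * h.coeff (I - p.1 - p.2)) := by
    apply NonarchimedeanAddGroup.summable_of_tendsto_cofinite_zero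
    obtain ⟨r, hr⟩ := U.isConnected.nonempty
    have hinj : Function.Injective
        (fun p : (Fin n → ℤ) × (Fin n → ℤ) => (p.1, (p.2, I - p.1 - p.2))) :=
      fun a b hab => by simp only [Prod.mk.injEq] at hab; exact Prod.ext hab.1 hab.2.1
    have ht := ((tendsto_mul_cofinite_nhds_zero (f.tendsto hr)
      (tendsto_mul_cofinite_nhds_zero (g.tendsto hr) (h.tendsto hr))).comp
        hinj.tendsto_cofinite).mul_const ((mon r I : ℝ)⁻¹)
    rw [zero_mul] at ht
    rw [tendsto_zero_iff_norm_tendsto_zero]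
    refine ht.congr fun p => ?_
    have e : (mon r I : ℝ) = mon r p.1 * (mon r p.2 * mon r (I - p.1 - p.2)) := by
      have : mon r I = mon r p.1 * (mon r p.2 * mon r (I - p.1 - p.2)) := by
        rw [← mon_add, ← mon_add]; congr 1; abel
      rw [this, Positive.val_mul, Positive.val_mul]
    have h0 := (mon r I).2.ne'
    simp only [Function.comp_apply, norm_mul]
    rw [← div_eq_mul_inv, div_eq_iff h0, e]; ring
  let e : (Fin n → ℤ) × (Fin n → ℤ) ≃ (Fin n → ℤ) × (Fin n → ℤ) :=
    { toFun := fun p => (p.2, p.1 - p.2)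
      invFun := fun q => (q.1 + q.2, q.1)
      left_inv := fun p => by simp
      right_inv := fun q => by simp }
  have hs' := (e.summable_iff).2 hs
  have h1 : (f * (g * h)).coeff I = ∑' p : (Fin n → ℤ) × (Fin n → ℤ),
      f.coeff p.1 * (g.coeff p.2 * h.coeff (I - p.1 - p.2)) := by
    rw [hs.tsum_prod, coeff_mul]
    refine tsum_congr fun J => ?_
    rw [coeff_mul]
    exact ((summable_conv g h (I - J)).tsum_mul_left _).symm
  have h2 : (f * g * h).coeff I = ∑' p : (Fin n → ℤ) × (Fin n → ℤ),
      f.coeff p.1 * (g.coeff p.2 * h.coeff (I - p.1 - p.2)) := by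
    rw [← e.tsum_eq]
    refine Eq.trans ?_ (hs'.tsum_prod).symm
    rw [coeff_mul]
    refine tsum_congr fun K => ?_
    rw [coeff_mul, ← (summable_conv f g K).tsum_mul_right]
    refine tsum_congr fun J => ?_
    simp [e, mul_assoc]
  rw [h1, h2]

instance : CommRing (LaceFun k U) :=
  { (inferInstance : AddCommGroup (LaceFun k U)) with
    mul := (· * ·)
    one := 1
    mul_assoc := LaceFun.mul_assoc'
    one_mul := LaceFun.one_mul'
    mul_one := fun f => by rw [LaceFun.mul_comm', LaceFun.one_mul']
    left_distrib := LaceFun.left_distrib'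
    right_distrib := fun f g h => by
      rw [LaceFun.mul_comm', LaceFun.left_distrib', LaceFun.mul_comm' h f, LaceFun.mul_comm' h g]
    mul_comm := LaceFun.mul_comm'
    zero_mul := fun f => by ext I; simp [coeff_mul]
    mul_zero := fun f => by ext I; simp [coeff_mul] }

protected lemma smul_mul' (c : k) (f g : LaceFun k U) : (c • f) * g = c • (f * g) := by
  ext I
  rw [coeff_mul, coeff_smul, coeff_mul, ← (summable_conv f g I).tsum_mul_left]
  exact tsum_congr fun J => by simp [mul_assoc]

instance : Algebra k (LaceFun k U) :=
  Algebra.ofModule LaceFun.smul_mul' fun c f g => by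
    rw [mul_comm, LaceFun.smul_mul', mul_comm]

/-- The coordinate function `Tᵢ` on `D_U`. -/
def coord (U : LaceType n) (i : Fin n) : LaceFun k U := single (Pi.single i 1) 1

/-- Restriction of functions from `D_U` to `D_P`, for `P ⊆ U`. -/
def restrict {P U : LaceType n} (h : P.carrier ⊆ U.carrier) : LaceFun k U →ₐ[k] LaceFun k P :=
  AlgHom.ofLinearMap
    { toFun := fun f => ⟨f.1, fun r hr => f.2 r (h hr)⟩
      map_add' := fun _ _ => rfl
      map_smul' := fun _ _ => rfl }
    rfl (fun _ _ => rfl)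

/-- The partial sum `∑_{I ∈ F} a_I T^I` of `f = ∑_I a_I T^I`. -/
def partialSum (f : LaceFun k U) (F : Finset (Fin n → ℤ)) : LaurentPoly k n :=
  ∑ I ∈ F, AddMonoidAlgebra.single I (f.coeff I)

/-- The absolute value `|f(x)|` of the analytic function `f` at a point `x` of `D_U`: the limit of
the absolute values at `x` of the partial sums of `f`. -/
def absAt (f : LaceFun k U) (x : TorusPoint k n) : ℝ≥0 :=
  limUnder atTop fun F : Finset (Fin n → ℤ) => x.val (f.partialSum F)

/-- The limit defining `|f(x)|` exists. -/
lemma tendsto_absAt (f : LaceFun k U) {x : TorusPoint k n} (hx : x ∈ domain k U) :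
    Tendsto (fun F : Finset (Fin n → ℤ) => x.val (f.partialSum F)) atTop (𝓝 (f.absAt x)) := by
  suffices hc : CauchySeq fun F : Finset (Fin n → ℤ) => x.val (f.partialSum F) from
    CauchySeq.tendsto_limUnder hc
  rw [Metric.cauchySeq_iff']
  intro ε hε
  have h := (Metric.tendsto_nhds.1 (f.tendsto hx)) ε hε
  rw [Filter.eventually_cofinite] at h
  refine ⟨h.toFinset, fun F hF => ?_⟩
  obtain ⟨δ, rfl⟩ : ∃ δ : ℝ≥0, (δ : ℝ) = ε := ⟨⟨ε, hε.le⟩, rfl⟩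
  have hd : f.partialSum F - f.partialSum h.toFinset =
      ∑ I ∈ F \ h.toFinset, AddMonoidAlgebra.single I (f.coeff I) := by
    rw [partialSum, partialSum, sub_eq_iff_eq_add, Finset.sum_sdiff hF]
  have hlt : x.val (f.partialSum F - f.partialSum h.toFinset) < δ := by
    rw [hd]
    refine Valuation.map_sum_lt _ (NNReal.coe_pos.1 hε).ne' fun I hI => ?_
    rw [← NNReal.coe_lt_coe, x.val_single]
    rw [Finset.mem_sdiff, Set.Finite.mem_toFinset] at hI
    have := not_not.1 hI.2
    rw [Real.dist_eq, sub_zero] at this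
    exact (le_abs_self _).trans_lt this
  rw [NNReal.dist_eq]
  have h0 := NNReal.coe_nonneg (x.val (f.partialSum F))
  have h0' := NNReal.coe_nonneg (x.val (f.partialSum h.toFinset))
  rcases lt_trichotomy (x.val (f.partialSum F)) (x.val (f.partialSum h.toFinset)) with hl | he | hg
  · rw [Valuation.map_sub_eq_of_lt_right _ hl] at hlt
    have h1 := NNReal.coe_lt_coe.2 hlt
    have h2 := NNReal.coe_lt_coe.2 hl
    rw [abs_lt]; constructor <;> linarith
  · rw [he]; simpa using hε
  · rw [Valuation.map_sub_eq_of_lt_left _ hg] at hlt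
    have h1 := NNReal.coe_lt_coe.2 hlt
    have h2 := NNReal.coe_lt_coe.2 hg
    rw [abs_lt]; constructor <;> linarith

/-- The norm `‖f‖_r = max_I |a_I| r^I`, for `r ∈ U`; it is `|f|` at the point `η_r`. -/
def gaussNorm (r : Fin n → PosReal) (f : LaceFun k U) : ℝ := ⨆ I, ‖f.coeff I‖ * (mon r I : ℝ)

/-- Topologically nilpotent functions (`A_U^{∘∘}`): those with `f^m → 0` in `A_U`, whose topology is
given by the norms `‖·‖_r`, `r ∈ U`. -/
def IsTopNilpotent (f : LaceFun k U) : Prop :=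
  ∀ r ∈ U.carrier, Tendsto (fun m : ℕ => gaussNorm r (f ^ m)) atTop (𝓝 0)

/-- `f` has a strictly dominant monomial of multidegree `I`. -/
def HasStrictlyDominantMonomial (f : LaceFun k U) (I : Fin n → ℤ) : Prop :=
  ∀ r ∈ U.carrier, ∀ J, J ≠ I → ‖f.coeff J‖ * (mon r J : ℝ) < ‖f.coeff I‖ * (mon r I : ℝ)

end LaceFun

end Functions

/-! ### Morphisms, coordinate systems and the lattice -/

section Morphisms

variable (k : Type*) [NormedField k] [IsUltrametricDist k] [CompleteSpace k] {n : ℕ}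

/-- A morphism of `k`-analytic spaces `D_U → D_V`: a continuous map together with a compatible
morphism of structure sheaves, given on the analytic domains `D_P ⊆ D_U` and `D_Q ⊆ D_V`
with `φ(D_P) ⊆ D_Q` as a `k`-algebra morphism `A_Q → A_P` such that `|φ^* g (x)| = |g (φ(x))|`. -/
structure LaceHom (U V : LaceType n) where
  toFun : domain k U → domain k V
  continuous_toFun : Continuous toFun
  pullback : ∀ P Q : LaceType n, P.carrier ⊆ U.carrier → Q.carrier ⊆ V.carrier →
    (∀ x : domain k U, x.1 ∈ domain k P → (toFun x).1 ∈ domain k Q) →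
      (LaceFun k Q →ₐ[k] LaceFun k P)
  pullback_restrict : ∀ (P Q P' Q' : LaceType n) hP hQ h hP' hQ' h'
    (hPP : P'.carrier ⊆ P.carrier) (hQQ : Q'.carrier ⊆ Q.carrier) (g : LaceFun k Q),
      pullback P' Q' hP' hQ' h' (LaceFun.restrict hQQ g) =
        LaceFun.restrict hPP (pullback P Q hP hQ h g)
  absAt_pullback : ∀ (P Q : LaceType n) hP hQ h (g : LaceFun k Q) (x : domain k U),
    x.1 ∈ domain k P → (pullback P Q hP hQ h g).absAt x.1 = g.absAt (toFun x).1

variable {k}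

/-- The morphism `A_V → A_U` induced by `φ : D_U → D_V` on global functions. -/
def LaceHom.globalPullback {U V : LaceType n} (φ : LaceHom k U V) :
    LaceFun k V →ₐ[k] LaceFun k U :=
  φ.pullback U V subset_rfl subset_rfl fun x _ => (φ.toFun x).2

/-- Isomorphisms: homeomorphisms such that, whenever `φ` identifies `D_P` with `D_Q`, the morphism
`A_Q → A_P` is an isomorphism. -/
def LaceHom.IsIso {U V : LaceType n} (φ : LaceHom k U V) : Prop :=
  IsHomeomorph φ.toFun ∧
    ∀ (P Q : LaceType n) (hP : P.carrier ⊆ U.carrier) (hQ : Q.carrier ⊆ V.carrier)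
      (h : ∀ x : domain k U, x.1 ∈ domain k P ↔ (φ.toFun x).1 ∈ domain k Q),
        Function.Bijective (φ.pullback P Q hP hQ fun x => (h x).1)

/-- `(f₁, …, fₙ)` is a coordinate system on `D_U`: it induces an isomorphism `D_U ≃ D_V` for some
nonempty connected piecewise `ℤ`-linear `V ⊆ (ℝ₊^×)ⁿ`. -/
def IsCoordinateSystem {U : LaceType n} (f : Fin n → LaceFun k U) : Prop :=
  ∃ (V : LaceType n) (φ : LaceHom k U V), φ.IsIso ∧
    ∀ i, φ.globalPullback (LaceFun.coord V i) = f i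

variable (k) in
/-- The subgroup `k^× (1 + A_U^{∘∘})` of `A_U^×`. -/
def dominatedUnits (U : LaceType n) : Subgroup (LaceFun k U)ˣ :=
  (Units.map (algebraMap k (LaceFun k U)).toMonoidHom).range ⊔
    Subgroup.closure {u | ((u : LaceFun k U) - 1).IsTopNilpotent}

variable (k) in
/-- The lattice `A_U^× / k^× (1 + A_U^{∘∘})` of `D_U`, an abelian group written additively. -/
def Lattice (U : LaceType n) : Type _ := Additive ((LaceFun k U)ˣ ⧸ dominatedUnits k U)

instance (U : LaceType n) : AddCommGroup (Lattice k U) :=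
  inferInstanceAs (AddCommGroup (Additive ((LaceFun k U)ˣ ⧸ dominatedUnits k U)))

/-- The class in the lattice of an invertible function. -/
def Lattice.mk {U : LaceType n} (u : (LaceFun k U)ˣ) : Lattice k U :=
  Additive.ofMul (QuotientGroup.mk u : (LaceFun k U)ˣ ⧸ dominatedUnits k U)

end Morphisms

end Dentelle

end

noncomputable section

namespace Dentelle

/-! Everything rests on the multidegree of a unit. Each norm `‖·‖_r` is multiplicative
(`gaussNorm_mul`), so if `uv = 1`, the sets of multidegrees where `u` and `v` are maximal at `r`
must be singletons: otherwise the two-unique-sums property of `ℤⁿ` would make two different products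
of maximal terms survive in `1` (`exists_dominant_at`). Series in `A_U` decay locally uniformly on
`U`, so the dominant multidegree is locally constant, hence constant as `U` is connected
(`exists_hasStrictlyDominantMonomial`). Conversely, a function with a nonzero strictly dominant term
is `cT^I(1+h)` with `‖h‖_r < 1` for all `r`, and is inverted by a geometric series. The multidegree
is therefore a surjection `A_U^× → ℤⁿ` with kernel `k^×(1+A_U^{∘∘})` (`ker_degHom`), which gives the
lattice; `exists_basis_iff` then reduces the third claim to the first.

An isomorphism `D_U ≃ D_V` is bijective on global functions and preserves the condition `‖h‖ < 1`,
so it induces a surjective endomorphism of `ℤⁿ` on multidegrees (`deg_map_globalPullback`); its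
matrix has the multidegrees of the `fᵢ` as rows. Conversely, given units `fᵢ` with invertible degree
matrix, let `V` be the image of `U` under the monomial map `r ↦ (‖fᵢ‖_r)ᵢ`. At each `r`, the
substitution `Tᵢ ↦ fᵢ` differs from the substitution of the leading monomials, an isometric
isomorphism, by an operator of relative norm `ρ < 1`. Hence it is isometric and bijective
(`gaussNorm_subst`, `bijective_subst`), as is its analogue on each pair of subdomains that
correspond to each other, and it induces the required isomorphism on points. -/

lemma exists_forall_le_of_tendsto_cofinite {ι : Type*} [Nonempty ι] {u : ι → ℝ}
    (h : Tendsto u cofinite (𝓝 0)) (hu : ∀ i, 0 ≤ u i) : ∃ i, ∀ j, u j ≤ u i := by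
  by_cases hpos : ∃ j, 0 < u j
  · obtain ⟨j, hj⟩ := hpos
    have hfin : {i | ¬ u i < u j}.Finite := eventually_cofinite.1 (h.eventually (gt_mem_nhds hj))
    obtain ⟨i, hi, hmax⟩ := Set.exists_max_image _ u hfin ⟨j, lt_irrefl _⟩
    refine ⟨i, fun l => ?_⟩
    by_cases hl : u l < u j
    · exact hl.le.trans (not_lt.1 hi)
    · exact hmax l hl
  · push Not at hpos
    obtain ⟨i⟩ := ‹Nonempty ι›
    exact ⟨i, fun j => (hpos j).trans (hu i)⟩

/-- The inequality stays strict because the supremum of a null family of norms is attained. -/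
lemma norm_tsum_lt_of_forall_lt {M ι : Type*} [SeminormedAddCommGroup M] [IsUltrametricDist M]
    [Nonempty ι] {f : ι → M} {C : ℝ} (hf : Tendsto (fun i => ‖f i‖) cofinite (𝓝 0))
    (h : ∀ i, ‖f i‖ < C) : ‖∑' i, f i‖ < C := by
  obtain ⟨i, hi⟩ := exists_forall_le_of_tendsto_cofinite hf fun i => norm_nonneg _
  exact (IsUltrametricDist.norm_tsum_le_of_forall_le_of_nonneg (norm_nonneg _) hi).trans_lt (h i)

lemma mon_zero {n : ℕ} (r : Fin n → PosReal) : mon r 0 = 1 := by simp [mon]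

lemma mon_pos {n : ℕ} (r : Fin n → PosReal) (I : Fin n → ℤ) : (0 : ℝ) < mon r I := (mon r I).2

/-! ### Gauss norms and dominance at a single radius. -/

namespace LaceFun

variable {k : Type*} [NormedField k] {n : ℕ} {U : LaceType n} {r : Fin n → PosReal}

@[simp] lemma coeff_neg (f : LaceFun k U) (I) : (-f).coeff I = -f.coeff I := rfl
@[simp] lemma coeff_sub (f g : LaceFun k U) (I) : (f - g).coeff I = f.coeff I - g.coeff I := rfl

lemma coeff_sum {ι : Type*} (s : Finset ι) (f : ι → LaceFun k U) (I) :
    (∑ i ∈ s, f i).coeff I = ∑ i ∈ s, (f i).coeff I := by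
  classical
  induction s using Finset.induction_on with
  | empty => simp
  | insert a s ha ih => simp [Finset.sum_insert ha, ih]

lemma term_nonneg (f : LaceFun k U) (r) (I) : 0 ≤ ‖f.coeff I‖ * (mon r I : ℝ) :=
  mul_nonneg (norm_nonneg _) (mon_pos r I).le

lemma le_gaussNorm (f : LaceFun k U) (hr : r ∈ U.carrier) (I) :
    ‖f.coeff I‖ * (mon r I : ℝ) ≤ gaussNorm r f :=
  le_ciSup (f.tendsto hr).bddAbove_range_of_cofinite I

lemma gaussNorm_nonneg (f : LaceFun k U) : 0 ≤ gaussNorm r f :=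
  Real.iSup_nonneg fun I => f.term_nonneg r I

lemma gaussNorm_le {f : LaceFun k U} {C : ℝ} (h : ∀ I, ‖f.coeff I‖ * (mon r I : ℝ) ≤ C) :
    gaussNorm r f ≤ C := ciSup_le h

lemma exists_eq_gaussNorm (f : LaceFun k U) (hr : r ∈ U.carrier) :
    ∃ I, ‖f.coeff I‖ * (mon r I : ℝ) = gaussNorm r f := by
  obtain ⟨I, hI⟩ := exists_forall_le_of_tendsto_cofinite (f.tendsto hr) (f.term_nonneg r)
  exact ⟨I, (f.le_gaussNorm hr I).antisymm (gaussNorm_le hI)⟩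

lemma gaussNorm_lt_iff {f : LaceFun k U} (hr : r ∈ U.carrier) {C : ℝ} :
    gaussNorm r f < C ↔ ∀ I, ‖f.coeff I‖ * (mon r I : ℝ) < C := by
  refine ⟨fun h I => (f.le_gaussNorm hr I).trans_lt h, fun h => ?_⟩
  obtain ⟨I, hI⟩ := f.exists_eq_gaussNorm hr
  exact hI ▸ h I

lemma gaussNorm_zero : gaussNorm r (0 : LaceFun k U) = 0 := by simp [gaussNorm]

lemma gaussNorm_eq_zero {f : LaceFun k U} (hr : r ∈ U.carrier) : gaussNorm r f = 0 ↔ f = 0 := by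
  refine ⟨fun h => ?_, fun h => h ▸ gaussNorm_zero⟩
  ext I
  have h1 := (f.le_gaussNorm hr I).trans h.le
  have h2 := mon_pos r I
  have h3 := norm_nonneg (f.coeff I)
  exact norm_eq_zero.1 (le_antisymm (nonpos_of_mul_nonpos_left h1 h2) h3)

lemma gaussNorm_pos {f : LaceFun k U} (hr : r ∈ U.carrier) (hf : f ≠ 0) : 0 < gaussNorm r f :=
  lt_of_le_of_ne f.gaussNorm_nonneg fun h => hf ((gaussNorm_eq_zero hr).1 h.symm)

lemma gaussNorm_single (I : Fin n → ℤ) (c : k) :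
    gaussNorm r (single I c : LaceFun k U) = ‖c‖ * mon r I := by
  have h : ∀ J, ‖(single I c : LaceFun k U).coeff J‖ * (mon r J : ℝ) ≤ ‖c‖ * mon r I := by
    intro J
    by_cases hJ : J = I
    · subst hJ; simp
    · rw [coeff_single_ne hJ]; simpa using mul_nonneg (norm_nonneg c) (mon_pos r I).le
  refine (gaussNorm_le h).antisymm ?_
  have := le_ciSup (f := fun J => ‖(single I c : LaceFun k U).coeff J‖ * (mon r J : ℝ))
    ⟨_, Set.forall_mem_range.2 h⟩ I
  simpa [gaussNorm] using this

lemma gaussNorm_one : gaussNorm r (1 : LaceFun k U) = 1 := by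
  rw [one_def, gaussNorm_single, norm_one, mon_zero]; simp

lemma gaussNorm_neg (f : LaceFun k U) : gaussNorm r (-f) = gaussNorm r f := by
  simp [gaussNorm]

lemma gaussNorm_sub_comm (f g : LaceFun k U) : gaussNorm r (f - g) = gaussNorm r (g - f) := by
  rw [← gaussNorm_neg, neg_sub]

lemma gaussNorm_smul (c : k) (f : LaceFun k U) : gaussNorm r (c • f) = ‖c‖ * gaussNorm r f := by
  simp only [gaussNorm, coeff_smul, norm_mul, mul_assoc]
  rw [Real.mul_iSup_of_nonneg (norm_nonneg c)]

lemma HasStrictlyDominantMonomial.eq {f : LaceFun k U} {I J : Fin n → ℤ}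
    (hI : f.HasStrictlyDominantMonomial I) (hJ : f.HasStrictlyDominantMonomial J) : I = J := by
  obtain ⟨r, hr⟩ := U.isConnected.nonempty
  by_contra h
  exact lt_asymm (hI r hr J (Ne.symm h)) (hJ r hr I h)

lemma term_mul_le (f g : LaceFun k U) (hr : r ∈ U.carrier) (I J : Fin n → ℤ) :
    ‖f.coeff J * g.coeff (I - J)‖ * (mon r I : ℝ) ≤ gaussNorm r f * gaussNorm r g := by
  have : (mon r I : ℝ) = mon r J * mon r (I - J) := by
    rw [← Positive.val_mul, ← mon_add, add_sub_cancel]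
  rw [norm_mul, this, mul_mul_mul_comm]
  exact mul_le_mul (f.le_gaussNorm hr _) (g.le_gaussNorm hr _) (g.term_nonneg r _)
    f.gaussNorm_nonneg

/-- The multidegrees where the terms of a nonzero function are maximal at `r` form a nonempty
finite set. -/
lemma exists_support_gaussNorm {f : LaceFun k U} (hr : r ∈ U.carrier) (hf : f ≠ 0) :
    ∃ A : Finset (Fin n → ℤ), A.Nonempty ∧
      ∀ I, I ∈ A ↔ ‖f.coeff I‖ * (mon r I : ℝ) = gaussNorm r f := by
  have hpos := gaussNorm_pos hr hf
  have hfin : {I | ¬ ‖f.coeff I‖ * (mon r I : ℝ) < gaussNorm r f}.Finite :=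
    eventually_cofinite.1 ((f.tendsto hr).eventually (gt_mem_nhds hpos))
  have key : ∀ I, I ∈ hfin.toFinset ↔ ‖f.coeff I‖ * (mon r I : ℝ) = gaussNorm r f := by
    intro I
    rw [Set.Finite.mem_toFinset, Set.mem_ofPred_eq, not_lt]
    exact ⟨fun h => (f.le_gaussNorm hr I).antisymm h, fun h => h.ge⟩
  obtain ⟨I, hI⟩ := f.exists_eq_gaussNorm hr
  exact ⟨hfin.toFinset, ⟨I, (key I).2 hI⟩, key⟩

lemma HasStrictlyDominantMonomial.gaussNorm_eq {f : LaceFun k U} {I : Fin n → ℤ}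
    (h : f.HasStrictlyDominantMonomial I) (hr : r ∈ U.carrier) :
    gaussNorm r f = ‖f.coeff I‖ * mon r I := by
  refine le_antisymm (gaussNorm_le fun J => ?_) (f.le_gaussNorm hr I)
  by_cases hJ : J = I
  · rw [hJ]
  · exact (h r hr J hJ).le

/-- The index `i` witnesses `n > 0`, so that there is another multidegree to compare with. For `n =
0` dominance is vacuous and holds even for `f = 0`; this is why nonvanishing of the leading
coefficient is often a separate hypothesis below. -/
lemma HasStrictlyDominantMonomial.coeff_ne_zero {f : LaceFun k U} {I : Fin n → ℤ}
    (h : f.HasStrictlyDominantMonomial I) (i : Fin n) : f.coeff I ≠ 0 := by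
  intro h0
  obtain ⟨r, hr⟩ := U.isConnected.nonempty
  have hne : I + Pi.single i 1 ≠ I := by simp
  have := h r hr _ hne
  rw [h0, norm_zero, zero_mul] at this
  exact not_lt.2 (f.term_nonneg r _) this

lemma smul_single (I : Fin n → ℤ) (c d : k) :
    c • (single I d : LaceFun k U) = single I (c * d) := by
  ext L
  rw [coeff_smul]
  by_cases h : L = I
  · subst h; simp
  · rw [coeff_single_ne h, coeff_single_ne h, mul_zero]

variable [IsUltrametricDist k]

lemma gaussNorm_add_le (f g : LaceFun k U) (hr : r ∈ U.carrier) :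
    gaussNorm r (f + g) ≤ max (gaussNorm r f) (gaussNorm r g) := by
  refine gaussNorm_le fun I => ?_
  have hm := mon_pos r I
  calc ‖(f + g).coeff I‖ * (mon r I : ℝ)
      ≤ max ‖f.coeff I‖ ‖g.coeff I‖ * (mon r I : ℝ) :=
        mul_le_mul_of_nonneg_right (IsUltrametricDist.norm_add_le_max _ _) hm.le
    _ = max (‖f.coeff I‖ * (mon r I : ℝ)) (‖g.coeff I‖ * (mon r I : ℝ)) :=
        max_mul_of_nonneg _ _ hm.le
    _ ≤ _ := max_le_max (f.le_gaussNorm hr I) (g.le_gaussNorm hr I)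

lemma gaussNorm_sub_le (f g : LaceFun k U) (hr : r ∈ U.carrier) :
    gaussNorm r (f - g) ≤ max (gaussNorm r f) (gaussNorm r g) := by
  rw [sub_eq_add_neg, ← gaussNorm_neg g]; exact gaussNorm_add_le _ _ hr

lemma gaussNorm_sum_le {ι : Type*} (s : Finset ι) (f : ι → LaceFun k U) (hr : r ∈ U.carrier)
    {C : ℝ} (hC : 0 ≤ C) (h : ∀ i ∈ s, gaussNorm r (f i) ≤ C) :
    gaussNorm r (∑ i ∈ s, f i) ≤ C := by
  classical
  induction s using Finset.induction_on with
  | empty => simpa [gaussNorm_zero] using hC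
  | insert a s ha ih =>
    rw [Finset.sum_insert ha]
    exact (gaussNorm_add_le _ _ hr).trans (max_le (h a (Finset.mem_insert_self _ _))
      (ih fun i hi => h i (Finset.mem_insert_of_mem hi)))

lemma gaussNorm_add_eq_left {f g : LaceFun k U} (hr : r ∈ U.carrier)
    (h : gaussNorm r g < gaussNorm r f) : gaussNorm r (f + g) = gaussNorm r f := by
  refine le_antisymm ((gaussNorm_add_le f g hr).trans (max_le le_rfl h.le)) ?_
  have := gaussNorm_sub_le (f + g) g hr
  rw [add_sub_cancel_right] at this
  rcases le_max_iff.1 this with h1 | h1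
  · exact h1
  · exact absurd h1 (not_le.2 h)

lemma gaussNorm_mul_le (f g : LaceFun k U) (hr : r ∈ U.carrier) :
    gaussNorm r (f * g) ≤ gaussNorm r f * gaussNorm r g := by
  refine gaussNorm_le fun I => ?_
  rw [← le_div_iff₀ (mon_pos r I), coeff_mul]
  refine IsUltrametricDist.norm_tsum_le_of_forall_le_of_nonneg
    (div_nonneg (mul_nonneg f.gaussNorm_nonneg g.gaussNorm_nonneg) (mon_pos r I).le) fun J => ?_
  rw [le_div_iff₀ (mon_pos r I)]
  exact f.term_mul_le g hr I J

variable [CompleteSpace k]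

/-- In the convolution sum for `a + b` the term `J = a` has the largest possible size. Another term
of that size would need both factors maximal, hence give a second decomposition of `a + b` in `A +
B`. So the ultrametric inequality is an equality. -/
lemma term_mul_eq_of_uniqueAdd {f g : LaceFun k U} (hr : r ∈ U.carrier) (hf : f ≠ 0) (hg : g ≠ 0)
    {A B : Finset (Fin n → ℤ)}
    (hA : ∀ I, I ∈ A ↔ ‖f.coeff I‖ * (mon r I : ℝ) = gaussNorm r f)
    (hB : ∀ I, I ∈ B ↔ ‖g.coeff I‖ * (mon r I : ℝ) = gaussNorm r g)
    {a b : Fin n → ℤ} (ha : a ∈ A) (hb : b ∈ B) (hab : UniqueAdd A B a b) :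
    ‖(f * g).coeff (a + b)‖ * (mon r (a + b) : ℝ) = gaussNorm r f * gaussNorm r g := by
  classical
  have hm := mon_pos r (a + b)
  set F : (Fin n → ℤ) → k := fun J => f.coeff J * g.coeff (a + b - J) with hF
  have hs : Summable F := summable_conv f g (a + b)
  have hFa : ‖F a‖ * (mon r (a + b) : ℝ) = gaussNorm r f * gaussNorm r g := by
    rw [← (hA a).1 ha, ← (hB b).1 hb, hF]
    simp only [add_sub_cancel_left, norm_mul, mon_add, Positive.val_mul]
    ring
  have hrest : ∀ J, ‖(if J = a then 0 else F J)‖ < ‖F a‖ := by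
    intro J
    rw [← mul_lt_mul_iff_left₀ hm, hFa]
    split_ifs with hJ
    · simpa using mul_pos (gaussNorm_pos hr hf) (gaussNorm_pos hr hg)
    · refine lt_of_le_of_ne (f.term_mul_le g hr _ _) fun heq => hJ ?_
      have h1 := f.le_gaussNorm hr J
      have h2 := g.le_gaussNorm hr (a + b - J)
      have e : (mon r (a + b) : ℝ) = mon r J * mon r (a + b - J) := by
        rw [← Positive.val_mul, ← mon_add, add_sub_cancel]
      rw [hF, norm_mul, e, mul_mul_mul_comm] at heq
      have hpf := gaussNorm_pos hr hf
      have hpg := gaussNorm_pos hr hg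
      have hJA : J ∈ A := by
        rw [hA]
        refine h1.antisymm (le_of_not_gt fun hlt => ?_)
        have := mul_lt_mul_of_lt_of_le_of_nonneg_of_pos hlt h2 (f.term_nonneg r J) hpg
        exact this.ne heq
      have hJB : a + b - J ∈ B := by
        rw [hB]
        refine h2.antisymm (le_of_not_gt fun hlt => ?_)
        have := (mul_le_mul_of_nonneg_right h1 (g.term_nonneg r _)).trans_lt
          (mul_lt_mul_of_pos_left hlt hpf)
        exact this.ne heq
      exact (hab hJA hJB (by abel)).1
  have htend : Tendsto (fun J => ‖(if J = a then 0 else F J)‖) cofinite (𝓝 0) := by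
    refine squeeze_zero (fun _ => norm_nonneg _) (fun J => ?_)
      (tendsto_zero_iff_norm_tendsto_zero.1 hs.tendsto_cofinite_zero)
    split_ifs
    · simp
    · rfl
  have hlt := norm_tsum_lt_of_forall_lt htend hrest
  rw [coeff_mul, hs.tsum_eq_add_tsum_ite a,
    IsUltrametricDist.norm_add_eq_max_of_norm_ne_norm hlt.ne', max_eq_left hlt.le, hFa]

/-- Gauss's lemma: finite nonempty subsets `A`, `B` of `ℤⁿ` have a uniquely represented sum, and the
corresponding coefficient of `f * g` attains the upper bound. -/
lemma gaussNorm_mul (f g : LaceFun k U) (hr : r ∈ U.carrier) :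
    gaussNorm r (f * g) = gaussNorm r f * gaussNorm r g := by
  by_cases hf : f = 0
  · simp [hf, gaussNorm_zero]
  by_cases hg : g = 0
  · simp [hg, gaussNorm_zero]
  obtain ⟨A, hA0, hA⟩ := exists_support_gaussNorm hr hf
  obtain ⟨B, hB0, hB⟩ := exists_support_gaussNorm hr hg
  obtain ⟨a, ha, b, hb, hab⟩ := UniqueSums.uniqueAdd_of_nonempty hA0 hB0
  refine (gaussNorm_mul_le f g hr).antisymm ?_
  rw [← term_mul_eq_of_uniqueAdd hr hf hg hA hB ha hb hab]
  exact le_gaussNorm _ hr _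

lemma gaussNorm_pow (f : LaceFun k U) (hr : r ∈ U.carrier) (m : ℕ) :
    gaussNorm r (f ^ m) = gaussNorm r f ^ m := by
  induction m with
  | zero => simp [gaussNorm_one]
  | succ m ih => rw [pow_succ, pow_succ, gaussNorm_mul _ _ hr, ih]

lemma isTopNilpotent_iff {f : LaceFun k U} :
    f.IsTopNilpotent ↔ ∀ r ∈ U.carrier, gaussNorm r f < 1 := by
  refine forall₂_congr fun r hr => ?_
  simp_rw [gaussNorm_pow f hr]
  rw [tendsto_pow_atTop_nhds_zero_iff, abs_of_nonneg f.gaussNorm_nonneg]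

/-- At every point of `U`, an invertible function has a strictly dominant term. -/
lemma exists_dominant_at (u : (LaceFun k U)ˣ) (hr : r ∈ U.carrier) :
    ∃ I, ∀ J, J ≠ I → ‖(u : LaceFun k U).coeff J‖ * (mon r J : ℝ) <
      ‖(u : LaceFun k U).coeff I‖ * (mon r I : ℝ) := by
  have hnt : (1 : LaceFun k U) ≠ 0 := fun h => by
    have := gaussNorm_one (r := r) (k := k) (U := U)
    rw [h, gaussNorm_zero] at this; exact zero_ne_one this
  have hf : (u : LaceFun k U) ≠ 0 := fun h => hnt (by rw [← u.mul_inv, h, zero_mul])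
  have hg : ((u⁻¹ : (LaceFun k U)ˣ) : LaceFun k U) ≠ 0 :=
    fun h => hnt (by rw [← u.mul_inv, h, mul_zero])
  obtain ⟨A, hA0, hA⟩ := exists_support_gaussNorm hr hf
  obtain ⟨B, hB0, hB⟩ := exists_support_gaussNorm hr hg
  -- Otherwise two distinct pairs have unique sums. Each sum is the multidegree of a nonzero
  -- coefficient of `u * u⁻¹ = 1`, so both vanish, and uniqueness identifies the pairs.
  have hcard : ¬ 1 < A.card * B.card := by
    intro hlt
    obtain ⟨⟨a, b⟩, hp, ⟨a', b'⟩, hp', hne, hu, hu'⟩ :=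
      TwoUniqueSums.uniqueAdd_of_one_lt_card hlt
    rw [Finset.mem_product] at hp hp'
    have hzero : ∀ {a b}, a ∈ A → b ∈ B → UniqueAdd A B a b → a + b = 0 := by
      intro a b ha hb hab
      have h := term_mul_eq_of_uniqueAdd hr hf hg hA hB ha hb hab
      by_contra h0
      rw [u.mul_inv, one_def, coeff_single_ne h0, norm_zero, zero_mul] at h
      exact (mul_pos (gaussNorm_pos hr hf) (gaussNorm_pos hr hg)).ne h
    have e := hzero hp.1 hp.2 hu
    have e' := hzero hp'.1 hp'.2 hu'
    have := hu hp'.1 hp'.2 (e'.trans e.symm)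
    exact hne (Prod.ext this.1.symm this.2.symm)
  have hA1 : A.card = 1 := by
    have h1 := hA0.card_pos
    have h2 := hB0.card_pos
    nlinarith
  obtain ⟨I, rfl⟩ := Finset.card_eq_one.1 hA1
  refine ⟨I, fun J hJ => ?_⟩
  rw [(hA I).1 (Finset.mem_singleton_self I)]
  refine lt_of_le_of_ne (le_gaussNorm _ hr J) fun h => hJ ?_
  exact Finset.mem_singleton.1 ((hA J).2 h)

end LaceFun

end Dentelle

namespace Dentelle

/-! ### Convergent sums in `A_U` and inversion by geometric series. -/

namespace LaceFun

variable {k : Type*} [NormedField k] [IsUltrametricDist k] {n : ℕ} {U : LaceType n}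
  {r : Fin n → PosReal} {ι : Type*}

/-- The sum of a family of functions that tends to zero for all the norms `‖·‖_r`. -/
def lsum (a : ι → LaceFun k U)
    (ha : ∀ r ∈ U.carrier, Tendsto (fun j => gaussNorm r (a j)) cofinite (𝓝 0)) :
    LaceFun k U :=
  ⟨fun I => ∑' j, (a j).coeff I, fun r hr => by
    rw [Metric.tendsto_nhds]
    intro ε hε
    have h := (ha r hr).eventually (gt_mem_nhds (half_pos hε))
    have hfin := eventually_cofinite.1 h
    have hev : ∀ᶠ I in cofinite, ∀ j ∈ hfin.toFinset,
        ‖(a j).coeff I‖ * (mon r I : ℝ) < ε / 2 := by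
      rw [Filter.eventually_all_finset]
      exact fun j _ => ((a j).tendsto hr).eventually (gt_mem_nhds (half_pos hε))
    filter_upwards [hev] with I hI
    have hm := mon_pos r I
    have hb : ∀ j, ‖(a j).coeff I‖ ≤ ε / 2 / (mon r I : ℝ) := by
      intro j
      rw [le_div_iff₀ hm]
      by_cases hj : gaussNorm r (a j) < ε / 2
      · exact ((a j).le_gaussNorm hr I).trans hj.le
      · exact (hI j (hfin.mem_toFinset.2 hj)).le
    have := IsUltrametricDist.norm_tsum_le_of_forall_le_of_nonneg
      (div_nonneg (half_pos hε).le hm.le) hb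
    rw [le_div_iff₀ hm] at this
    rw [Real.dist_eq, sub_zero, abs_of_nonneg (mul_nonneg (norm_nonneg _) hm.le)]
    linarith⟩

lemma coeff_lsum (a : ι → LaceFun k U) (ha) (I) : (lsum a ha).coeff I = ∑' j, (a j).coeff I := rfl

lemma gaussNorm_lsum_le (a : ι → LaceFun k U) (ha) (hr : r ∈ U.carrier) {C : ℝ} (hC : 0 ≤ C)
    (h : ∀ j, gaussNorm r (a j) ≤ C) : gaussNorm r (lsum a ha) ≤ C := by
  refine gaussNorm_le fun I => ?_
  have hm := mon_pos r I
  rw [← le_div_iff₀ hm, coeff_lsum]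
  refine IsUltrametricDist.norm_tsum_le_of_forall_le_of_nonneg (div_nonneg hC hm.le) fun j => ?_
  rw [le_div_iff₀ hm]
  exact ((a j).le_gaussNorm hr I).trans (h j)

lemma coeff_single_mul (I : Fin n → ℤ) (c : k) (f : LaceFun k U) (J) :
    (single I c * f).coeff J = c * f.coeff (J - I) := by
  rw [coeff_mul, tsum_eq_single I fun L hL => by rw [coeff_single_ne hL, zero_mul],
    coeff_single_same]

lemma single_mul_single (I J : Fin n → ℤ) (c d : k) :
    (single I c : LaceFun k U) * single J d = single (I + J) (c * d) := by
  ext L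
  rw [coeff_single_mul]
  by_cases h : L = I + J
  · subst h; simp
  · rw [coeff_single_ne h, coeff_single_ne (fun h' => h (by rw [← h']; abel)), mul_zero]

variable [CompleteSpace k]

lemma summable_coeff {a : ι → LaceFun k U}
    (ha : ∀ r ∈ U.carrier, Tendsto (fun j => gaussNorm r (a j)) cofinite (𝓝 0)) (I) :
    Summable fun j => (a j).coeff I := by
  apply NonarchimedeanAddGroup.summable_of_tendsto_cofinite_zero
  obtain ⟨r, hr⟩ := U.isConnected.nonempty
  rw [tendsto_zero_iff_norm_tendsto_zero]
  refine squeeze_zero (fun _ => norm_nonneg _) (fun j => ?_)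
    (by simpa using (ha r hr).mul_const ((mon r I : ℝ)⁻¹))
  rw [← div_eq_mul_inv, le_div_iff₀ (mon_pos r I)]
  exact (a j).le_gaussNorm hr I

lemma gaussNorm_lsum_sub_le (a : ι → LaceFun k U) (ha) (hr : r ∈ U.carrier) (s : Finset ι) {C : ℝ}
    (hC : 0 ≤ C) (h : ∀ j ∉ s, gaussNorm r (a j) ≤ C) :
    gaussNorm r (lsum a ha - ∑ j ∈ s, a j) ≤ C := by
  classical
  refine gaussNorm_le fun I => ?_
  have hm := mon_pos r I
  have hs := summable_coeff ha I
  have e : (lsum a ha - ∑ j ∈ s, a j).coeff I = ∑' j : {j // j ∉ s}, (a j).coeff I := by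
    rw [coeff_sub, coeff_lsum, coeff_sum, sub_eq_iff_eq_add', hs.sum_add_tsum_subtype_compl s]
  rw [← le_div_iff₀ hm, e]
  refine IsUltrametricDist.norm_tsum_le_of_forall_le_of_nonneg (div_nonneg hC hm.le) fun j => ?_
  rw [le_div_iff₀ hm]
  exact ((a j).le_gaussNorm hr I).trans (h j j.2)

lemma eq_of_forall_gaussNorm_sub_le {f g : LaceFun k U} (hr : r ∈ U.carrier)
    (h : ∀ ε > 0, gaussNorm r (f - g) ≤ ε) : f = g :=
  sub_eq_zero.1 ((gaussNorm_eq_zero hr).1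
    (le_antisymm (le_of_forall_pos_le_add fun ε hε => by simpa using h ε hε) (gaussNorm_nonneg _)))

/-- A perturbation of the identity by an operator that contracts all the norms is bijective. -/
lemma bijective_of_contraction (T : LaceFun k U →+ LaceFun k U)
    (h : ∀ r ∈ U.carrier, ∃ ρ : ℝ, 0 ≤ ρ ∧ ρ < 1 ∧
      ∀ f, gaussNorm r (T f - f) ≤ ρ * gaussNorm r f) : Function.Bijective T := by
  constructor
  · rw [injective_iff_map_eq_zero]
    intro f hf
    obtain ⟨r, hr⟩ := U.isConnected.nonempty
    obtain ⟨ρ, _, hρ, hT⟩ := h r hr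
    have := hT f
    rw [hf, zero_sub, gaussNorm_neg] at this
    by_contra h0
    have := gaussNorm_pos hr h0
    nlinarith
  · intro y
    -- Neumann series: `a m = (1 - T)^m y`, whose sum should be `T⁻¹ y`. The sum converges for every
    -- norm, with a ratio `ρ` that may depend on `r`.
    set a : ℕ → LaceFun k U := fun m => (fun f => f - T f)^[m] y with ha
    have ha0 : a 0 = y := rfl
    have hsucc : ∀ m, a (m + 1) = a m - T (a m) := fun m => Function.iterate_succ_apply' _ _ _
    have hnorm : ∀ r ∈ U.carrier, ∀ ρ : ℝ, 0 ≤ ρ →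
        (∀ f, gaussNorm r (T f - f) ≤ ρ * gaussNorm r f) →
        ∀ m, gaussNorm r (a m) ≤ ρ ^ m * gaussNorm r y := by
      intro r hr ρ hρ0 hT m
      induction m with
      | zero => simp [ha0]
      | succ m ih =>
        rw [hsucc, gaussNorm_sub_comm, pow_succ', mul_assoc]
        exact (hT _).trans (mul_le_mul_of_nonneg_left ih hρ0)
    have htend : ∀ r ∈ U.carrier, Tendsto (fun j => gaussNorm r (a j)) cofinite (𝓝 0) := by
      intro r hr
      obtain ⟨ρ, hρ0, hρ, hT⟩ := h r hr
      rw [Nat.cofinite_eq_atTop]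
      refine squeeze_zero (fun _ => gaussNorm_nonneg _) (hnorm r hr ρ hρ0 hT) ?_
      simpa using (tendsto_pow_atTop_nhds_zero_of_lt_one hρ0 hρ).mul_const (gaussNorm r y)
    have hTsum : ∀ M, T (∑ m ∈ Finset.range M, a m) = y - a M := by
      intro M
      induction M with
      | zero => simp [ha0]
      | succ M ih => rw [Finset.sum_range_succ, map_add, ih, hsucc]; abel
    refine ⟨lsum a htend, ?_⟩
    -- Each single norm separates elements of `A_U`, so the equation can be checked at one `r`.
    obtain ⟨r, hr⟩ := U.isConnected.nonempty
    obtain ⟨ρ, hρ0, hρ, hT⟩ := h r hr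
    have hTle : ∀ f, gaussNorm r (T f) ≤ gaussNorm r f := by
      intro f
      have := gaussNorm_add_le (T f - f) f hr
      rw [sub_add_cancel] at this
      refine this.trans (max_le ((hT f).trans ?_) le_rfl)
      exact mul_le_of_le_one_left (gaussNorm_nonneg _) hρ.le
    refine eq_of_forall_gaussNorm_sub_le hr fun ε hε => ?_
    have hlim : Tendsto (fun m => ρ ^ m * gaussNorm r y) atTop (𝓝 0) := by
      simpa using (tendsto_pow_atTop_nhds_zero_of_lt_one hρ0 hρ).mul_const (gaussNorm r y)
    obtain ⟨M, hM⟩ := (eventually_atTop.1 (hlim.eventually (gt_mem_nhds hε)))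
    have hsmall : ∀ m, M ≤ m → gaussNorm r (a m) ≤ ε := fun m hm =>
      (hnorm r hr ρ hρ0 hT m).trans (hM m hm).le
    have e : T (lsum a htend) - y = T (lsum a htend - ∑ m ∈ Finset.range M, a m) - a M := by
      rw [map_sub, hTsum]; abel
    rw [e]
    refine (gaussNorm_sub_le _ _ hr).trans (max_le ((hTle _).trans ?_) (hsmall M le_rfl))
    exact gaussNorm_lsum_sub_le a htend hr _ hε.le fun j hj =>
      hsmall j (by simpa using hj)

/-- Multiplication by `g` differs from the identity by an operator of norm `‖g - 1‖_r < 1`, so `1`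
is in its image. -/
lemma isUnit_of_gaussNorm_sub_one_lt {g : LaceFun k U}
    (h : ∀ r ∈ U.carrier, gaussNorm r (g - 1) < 1) : IsUnit g := by
  obtain ⟨x, hx⟩ := (bijective_of_contraction (AddMonoidHom.mulLeft g) fun r hr =>
    ⟨gaussNorm r (g - 1), gaussNorm_nonneg _, h r hr, fun f => by
      rw [AddMonoidHom.coe_mulLeft, ← gaussNorm_mul _ _ hr, sub_mul, one_mul]⟩).2 1
  exact IsUnit.of_mul_eq_one x hx

/-! ### Monomials and strictly dominant monomials -/

/-- An invertible monomial. -/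
def unitSingle (U : LaceType n) (I : Fin n → ℤ) (c : kˣ) : (LaceFun k U)ˣ where
  val := single I c
  inv := single (-I) (c⁻¹ : kˣ)
  val_inv := by rw [single_mul_single, add_neg_cancel, Units.mul_inv, one_def]
  inv_val := by rw [single_mul_single, neg_add_cancel, Units.inv_mul, one_def]

@[simp] lemma val_unitSingle (I : Fin n → ℤ) (c : kˣ) :
    (unitSingle U I c : LaceFun k U) = single I (c : k) := rfl

lemma unitSingle_mul (I J : Fin n → ℤ) (c d : kˣ) :
    unitSingle U I c * unitSingle U J d = unitSingle U (I + J) (c * d) :=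
  Units.ext (by simp [single_mul_single])

/-- Here `c` need not be the coefficient `f_I`: being closer to it than `‖c‖` already forces `‖f_I‖
= ‖c‖`. -/
lemma hasStrictlyDominantMonomial_of_sub_lt {f : LaceFun k U} {I : Fin n → ℤ} {c : k}
    (h : ∀ r ∈ U.carrier, gaussNorm r (f - single I c) < ‖c‖ * mon r I) :
    f.HasStrictlyDominantMonomial I := by
  intro r hr J hJ
  have h1 := (gaussNorm_lt_iff hr).1 (h r hr) J
  have h2 := (gaussNorm_lt_iff hr).1 (h r hr) I
  rw [coeff_sub, coeff_single_ne hJ, sub_zero] at h1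
  rw [coeff_sub, coeff_single_same, mul_lt_mul_iff_left₀ (mon_pos r I)] at h2
  have h3 : ‖f.coeff I‖ = ‖c‖ := by
    have h4 := IsUltrametricDist.norm_add_eq_max_of_norm_ne_norm h2.ne
    rw [sub_add_cancel, max_eq_right h2.le] at h4
    exact h4
  rwa [h3]

lemma HasStrictlyDominantMonomial.gaussNorm_sub_lt {f : LaceFun k U} {I : Fin n → ℤ}
    (h : f.HasStrictlyDominantMonomial I) (h0 : f.coeff I ≠ 0) (hr : r ∈ U.carrier) :
    gaussNorm r (f - single I (f.coeff I)) < ‖f.coeff I‖ * mon r I := by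
  rw [gaussNorm_lt_iff hr]
  intro J
  by_cases hJ : J = I
  · subst hJ
    rw [coeff_sub, coeff_single_same, sub_self, norm_zero, zero_mul]
    exact mul_pos (norm_pos_iff.2 h0) (mon_pos r J)
  · rw [coeff_sub, coeff_single_ne hJ, sub_zero]
    exact h r hr J hJ

lemma hasStrictlyDominantMonomial_single (I : Fin n → ℤ) (c : kˣ) :
    (single I (c : k) : LaceFun k U).HasStrictlyDominantMonomial I :=
  hasStrictlyDominantMonomial_of_sub_lt (c := (c : k)) fun r _ => by
    rw [sub_self, gaussNorm_zero]
    exact mul_pos (norm_pos_iff.2 c.ne_zero) (mon_pos r I)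

/-- Strictly dominant monomials multiply. -/
lemma HasStrictlyDominantMonomial.mul {f g : LaceFun k U} {I J : Fin n → ℤ}
    (hf : f.HasStrictlyDominantMonomial I) (hg : g.HasStrictlyDominantMonomial J)
    (hf0 : f.coeff I ≠ 0) (hg0 : g.coeff J ≠ 0) :
    (f * g).HasStrictlyDominantMonomial (I + J) := by
  refine hasStrictlyDominantMonomial_of_sub_lt (c := f.coeff I * g.coeff J) fun r hr => ?_
  have e : f * g - single (I + J) (f.coeff I * g.coeff J) =
      (f - single I (f.coeff I)) * g + single I (f.coeff I) * (g - single J (g.coeff J)) := by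
    rw [← single_mul_single]; ring
  have e' : ‖f.coeff I * g.coeff J‖ * (mon r (I + J) : ℝ) =
      (‖f.coeff I‖ * mon r I) * (‖g.coeff J‖ * mon r J) := by
    rw [norm_mul, mon_add, Positive.val_mul]; ring
  have pf := mul_pos (norm_pos_iff.2 hf0) (mon_pos r I)
  have pg := mul_pos (norm_pos_iff.2 hg0) (mon_pos r J)
  rw [e, e']
  refine (gaussNorm_add_le _ _ hr).trans_lt (max_lt ?_ ?_)
  · rw [gaussNorm_mul _ _ hr, hg.gaussNorm_eq hr]
    exact mul_lt_mul_of_pos_right (hf.gaussNorm_sub_lt hf0 hr) pg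
  · rw [gaussNorm_mul _ _ hr, gaussNorm_single]
    exact mul_lt_mul_of_pos_left (hg.gaussNorm_sub_lt hg0 hr) pf

/-- The factorisation `f = cT^I(1+h)` with `‖h‖_r < 1`. It serves for invertibility, for the kernel
of the degree, for pullbacks and for substitution. -/
lemma HasStrictlyDominantMonomial.gaussNorm_unitSingle_inv_mul_sub_one_lt {f : LaceFun k U}
    {I : Fin n → ℤ} (h : f.HasStrictlyDominantMonomial I) (c : kˣ) (hc : f.coeff I = c)
    (hr : r ∈ U.carrier) :
    gaussNorm r ((((unitSingle U I c)⁻¹ : (LaceFun k U)ˣ) : LaceFun k U) * f - 1) < 1 := by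
  have h1 := h.gaussNorm_sub_lt (by rw [hc]; exact c.ne_zero) hr
  have e : f - single I (f.coeff I) = (unitSingle U I c : LaceFun k U) *
      ((((unitSingle U I c)⁻¹ : (LaceFun k U)ˣ) : LaceFun k U) * f - 1) := by
    rw [mul_sub, Units.mul_inv_cancel_left, mul_one, val_unitSingle, hc]
  rw [e, gaussNorm_mul _ _ hr, val_unitSingle, gaussNorm_single, hc] at h1
  exact lt_of_mul_lt_mul_left (by simpa using h1)
    (mul_nonneg (norm_nonneg _) (mon_pos r I).le)

lemma HasStrictlyDominantMonomial.isUnit {f : LaceFun k U} {I : Fin n → ℤ}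
    (h : f.HasStrictlyDominantMonomial I) (h0 : f.coeff I ≠ 0) : IsUnit f := by
  have := isUnit_of_gaussNorm_sub_one_lt fun r hr =>
    h.gaussNorm_unitSingle_inv_mul_sub_one_lt (Units.mk0 _ h0) rfl hr
  have h2 := (unitSingle U I (Units.mk0 _ h0)).isUnit.mul this
  rwa [Units.mul_inv_cancel_left] at h2

end LaceFun

end Dentelle

namespace Dentelle

/-! ### Polytopes -/

/-- A compact polyhedron is the convex hull of finitely many of its points. -/
lemma exists_finite_subset_convexHull_of_polyhedron {n : ℕ} {ι : Type*} [Finite ι] (c : ι → ℝ)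
    (l : ι → (Fin n → ℝ) →ₗ[ℝ] ℝ) (hC : IsCompact {x | ∀ j, c j + l j x ≤ 0}) :
    ∃ S : Set (Fin n → ℝ), S.Finite ∧ S ⊆ {x | ∀ j, c j + l j x ≤ 0} ∧
      {x | ∀ j, c j + l j x ≤ 0} ⊆ convexHull ℝ S := by
  set C : Set (Fin n → ℝ) := {x | ∀ j, c j + l j x ≤ 0} with hCdef
  have hconv : Convex ℝ C := by
    intro x hx y hy a b ha hb hab j
    have h1 := mul_nonpos_of_nonneg_of_nonpos ha (hx j)
    have h2 := mul_nonpos_of_nonneg_of_nonpos hb (hy j)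
    have h3 : c j = a * c j + b * c j := by rw [← add_mul, hab, one_mul]
    rw [map_add, map_smul, map_smul, smul_eq_mul, smul_eq_mul, h3]
    linarith
  -- An extreme point is determined by its set of active constraints: if `x` and `y` have the same
  -- ones, then `x ± t(x - y)` stays in `C` for small `t > 0`, which forces `x = y`.
  have hfin : (C.extremePoints ℝ).Finite := by
    refine Set.Finite.of_finite_image
      (f := fun x => {j | c j + l j x = 0}) (Set.toFinite _) fun x hx y hy hxy => ?_
    have key : ∀ j, ∀ᶠ t : ℝ in 𝓝 0, c j + l j (x + t • (x - y)) ≤ 0 := by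
      intro j
      by_cases hj : c j + l j x = 0
      · have hj' : c j + l j y = 0 := (Set.ext_iff.1 hxy j).1 hj
        refine Eventually.of_forall fun t => ?_
        rw [map_add, map_smul, map_sub, smul_eq_mul,
          show l j x - l j y = 0 by linarith]
        linarith
      · have hlt : c j + l j x < 0 := lt_of_le_of_ne (hx.1 j) hj
        have hcont : Continuous fun t : ℝ => c j + l j (x + t • (x - y)) := by
          simp only [map_add, map_smul, smul_eq_mul]; fun_prop
        have := hcont.tendsto 0
        rw [zero_smul, add_zero] at this
        exact (this.eventually (gt_mem_nhds hlt)).mono fun t ht => ht.le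
    have hall := eventually_all.2 key
    have hneg : Tendsto (fun t : ℝ => -t) (𝓝 0) (𝓝 0) := by simpa using tendsto_neg (0 : ℝ)
    have hboth := (hall.and (hneg.eventually hall)).filter_mono
      (nhdsWithin_le_nhds (s := Set.Ioi 0))
    obtain ⟨t, ⟨h1, h2⟩, ht⟩ := (hboth.and self_mem_nhdsWithin).exists
    have hseg : x ∈ openSegment ℝ (x + t • (x - y)) (x + (-t) • (x - y)) :=
      ⟨1 / 2, 1 / 2, by norm_num, by norm_num, by norm_num, by
        ext i; simp; ring⟩
    have := hx.2 h1 h2 hseg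
    rw [add_eq_left, smul_eq_zero, sub_eq_zero] at this
    exact this.resolve_left (ne_of_gt ht)
  refine ⟨_, hfin, extremePoints_subset, ?_⟩
  -- Krein–Milman; the closure is superfluous since there are finitely many extreme points.
  have := closure_convexHull_extremePoints hC hconv
  rw [(hfin.isClosed_convexHull ℝ).closure_eq] at this
  exact this.ge

/-- Coordinatewise logarithm. -/
def logMap {n : ℕ} (t : Fin n → PosReal) (i : Fin n) : ℝ := Real.log (t i : ℝ)

lemma continuous_logMap {n : ℕ} : Continuous (logMap (n := n)) :=
  continuous_pi fun i => Continuous.log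
    (continuous_subtype_val.comp (continuous_apply i)) fun t => (t i).2.ne'

/-- Coordinatewise exponential. -/
def expMap {n : ℕ} (x : Fin n → ℝ) (i : Fin n) : PosReal := ⟨Real.exp (x i), Real.exp_pos _⟩

lemma logMap_expMap {n : ℕ} (x : Fin n → ℝ) : logMap (expMap x) = x := by
  ext i; simp [logMap, expMap]

/-- The linear form `x ↦ ∑ aᵢ xᵢ` with integral coefficients. -/
def intForm {n : ℕ} (a : Fin n → ℤ) : (Fin n → ℝ) →ₗ[ℝ] ℝ := ∑ i, (a i : ℝ) • LinearMap.proj i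

lemma val_mon {n : ℕ} (t : Fin n → PosReal) (a : Fin n → ℤ) :
    (mon t a : ℝ) = ∏ i, (t i : ℝ) ^ a i := by
  have h : ∀ s : Finset (Fin n), ((∏ i ∈ s, t i ^ a i : PosReal) : ℝ) =
      ∏ i ∈ s, (t i : ℝ) ^ a i := by
    intro s
    induction s using Finset.induction_on with
    | empty => simp
    | insert i s hi ih => rw [Finset.prod_insert hi, Finset.prod_insert hi, Positive.val_mul, ih,
        Positive.coe_zpow]
  exact h _

lemma log_mon {n : ℕ} (t : Fin n → PosReal) (a : Fin n → ℤ) :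
    Real.log (mon t a : ℝ) = intForm a (logMap t) := by
  rw [val_mon, Real.log_prod fun i _ => (zpow_pos (t i).2 _).ne']
  simp [intForm, logMap, Real.log_zpow]

lemma continuous_mon {n : ℕ} (a : Fin n → ℤ) :
    Continuous fun t : Fin n → PosReal => (mon t a : ℝ) := by
  simp_rw [val_mon]
  exact continuous_finsetProd _ fun i _ => Continuous.zpow₀
    (continuous_subtype_val.comp (continuous_apply i)) _ fun t => Or.inl (t i).2.ne'

lemma mon_le_mon_iff {n : ℕ} (s t : Fin n → PosReal) (a : Fin n → ℤ) :
    (mon s a : ℝ) ≤ mon t a ↔ intForm a (logMap s) ≤ intForm a (logMap t) := by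
  rw [← log_mon, ← log_mon, Real.log_le_log_iff (mon_pos s a) (mon_pos t a)]

lemma IsZAffine.continuous {n : ℕ} {φ : (Fin n → PosReal) → PosReal} (h : IsZAffine φ) :
    Continuous φ := by
  obtain ⟨r, a, h⟩ := h
  refine continuous_induced_rng.2 ?_
  have : (Subtype.val ∘ φ) = fun t => (r : ℝ) * mon t a := by
    ext t; rw [Function.comp_apply, h, Positive.val_mul]
  rw [this]
  exact continuous_const.mul (continuous_mon a)

/-- On a polytope, every monomial is bounded by its values at finitely many points. -/
lemma IsZPolytope.exists_finite {n : ℕ} {P : Set (Fin n → PosReal)} (hP : IsZPolytope P) :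
    ∃ S : Set (Fin n → PosReal), S.Finite ∧ S ⊆ P ∧
      ∀ r ∈ P, ∀ J : Fin n → ℤ, ∃ s ∈ S, (mon r J : ℝ) ≤ mon s J := by
  obtain ⟨hcomp, p, q, φ, hφ, hPeq⟩ := hP
  choose c a hca using hφ
  have hsub : ∀ i, {t | ∀ j, φ i j t ≤ 1} ⊆ P := fun i t ht => by rw [hPeq]; exact ⟨i, ht⟩
  have hmem : ∀ i j (t : Fin n → PosReal),
      φ i j t ≤ 1 ↔ Real.log (c i j) + intForm (a i j) (logMap t) ≤ 0 := by
    intro i j t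
    rw [hca, ← log_mon, ← Real.log_mul (c i j).2.ne' (mon_pos _ _).ne', ← Positive.val_mul,
      Real.log_nonpos_iff (c i j * mon t (a i j)).2.le, ← Positive.val_one, Subtype.coe_le_coe]
  have main : ∀ i, ∃ S : Set (Fin n → PosReal), S.Finite ∧ S ⊆ {t | ∀ j, φ i j t ≤ 1} ∧
      ∀ r ∈ {t | ∀ j, φ i j t ≤ 1}, ∀ J : Fin n → ℤ, ∃ s ∈ S, (mon r J : ℝ) ≤ mon s J := by
    intro i
    -- Compactness is assumed for the union only, but each piece is closed in it.
    have hPi : IsCompact {t | ∀ j, φ i j t ≤ 1} := by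
      refine hcomp.of_isClosed_subset ?_ (hsub i)
      rw [Set.ofPred_forall]
      exact isClosed_iInter fun j => isClosed_le (IsZAffine.continuous ⟨_, _, hca i j⟩)
        continuous_const
    have himg : logMap '' {t | ∀ j, φ i j t ≤ 1} =
        {x | ∀ j, Real.log (c i j) + intForm (a i j) x ≤ 0} := by
      ext x
      constructor
      · rintro ⟨t, ht, rfl⟩ j
        exact (hmem i j t).1 (ht j)
      · intro hx
        exact ⟨expMap x, fun j => (hmem i j _).2 (by rw [logMap_expMap]; exact hx j),
          logMap_expMap x⟩
    obtain ⟨S, hSfin, hSsub, hS⟩ := exists_finite_subset_convexHull_of_polyhedron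
      (fun j => Real.log (c i j)) (fun j => intForm (a i j))
      (by rw [← himg]; exact hPi.image continuous_logMap)
    refine ⟨expMap '' S, hSfin.image _, ?_, ?_⟩
    · rintro _ ⟨x, hx, rfl⟩ j
      rw [hmem, logMap_expMap]
      exact hSsub hx j
    · intro r hr J
      have hrS : logMap r ∈ convexHull ℝ S := hS (himg ▸ Set.mem_image_of_mem _ hr)
      -- In logarithmic coordinates a monomial is a linear form, so on a convex hull it is bounded
      -- by its value at one of the generating points.
      obtain ⟨x, hx, hle⟩ := ((intForm J).convexOn convex_univ).exists_ge_of_mem_convexHull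
        (Set.subset_univ S) hrS
      refine ⟨expMap x, Set.mem_image_of_mem _ hx, ?_⟩
      rwa [mon_le_mon_iff, logMap_expMap]
  choose S hSfin hSsub hS using main
  refine ⟨⋃ i, S i, Set.finite_iUnion hSfin, Set.iUnion_subset fun i => (hSsub i).trans (hsub i),
    fun r hr J => ?_⟩
  rw [hPeq] at hr
  obtain ⟨i, hi⟩ := hr
  obtain ⟨s, hs, hle⟩ := hS i r hi J
  exact ⟨s, Set.mem_iUnion.2 ⟨i, hs⟩, hle⟩

/-- The finite set `S` serves all `J` at once, so decay of the terms at the points of `S` becomes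
uniform decay on `N`. This is how piecewise `ℤ`-linearity enters the analysis. -/
lemma IsPiecewiseZLinear.exists_nhds {n : ℕ} {U : Set (Fin n → PosReal)}
    (hU : IsPiecewiseZLinear U) {y : Fin n → PosReal} (hy : y ∈ U) :
    ∃ N ∈ 𝓝[U] y, ∃ S : Set (Fin n → PosReal), S.Finite ∧ S ⊆ U ∧
      ∀ r ∈ N, ∀ J : Fin n → ℤ, ∃ s ∈ S, (mon r J : ℝ) ≤ mon s J := by
  obtain ⟨𝒮, hpoly, hsub, hcov⟩ := hU
  obtain ⟨F, hFfin, hF, -, hN⟩ := hcov y hy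
  have hex : ∀ P : F, ∃ S : Set (Fin n → PosReal), S.Finite ∧ S ⊆ P ∧
      ∀ r ∈ (P : Set _), ∀ J : Fin n → ℤ, ∃ s ∈ S, (mon r J : ℝ) ≤ mon s J :=
    fun P => (hpoly P (hF P.2)).exists_finite
  choose S hSfin hSsub hS using hex
  have := hFfin.to_subtype
  refine ⟨⋃₀ F, hN, ⋃ P, S P, Set.finite_iUnion hSfin,
    Set.iUnion_subset fun P => (hSsub P).trans (hsub P (hF P.2)), fun r hr J => ?_⟩
  obtain ⟨P, hP, hrP⟩ := hr
  obtain ⟨s, hs, hle⟩ := hS ⟨P, hP⟩ r hrP J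
  exact ⟨s, Set.mem_iUnion.2 ⟨⟨P, hP⟩, hs⟩, hle⟩

/-! ### Local uniformity, and constancy of the dominant multidegree on `U`. -/

namespace LaceFun

variable {k : Type*} [NormedField k] {n : ℕ} {U : LaceType n}

/-- The terms of an analytic function tend to zero locally uniformly on `U`. -/
lemma exists_nhds_uniform (f : LaceFun k U) {y : Fin n → PosReal} (hy : y ∈ U.carrier) :
    ∃ N ∈ 𝓝[U.carrier] y, ∀ ε > 0, ∀ᶠ J in cofinite, ∀ r ∈ N,
      ‖f.coeff J‖ * (mon r J : ℝ) < ε := by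
  obtain ⟨N, hN, S, hSfin, hSU, hS⟩ := U.isPiecewiseZLinear.exists_nhds hy
  refine ⟨N, hN, fun ε hε => ?_⟩
  have hev : ∀ᶠ J in cofinite, ∀ s ∈ S, ‖f.coeff J‖ * (mon s J : ℝ) < ε :=
    (eventually_all_finite hSfin).2 fun s hs => (f.tendsto (hSU hs)).eventually (gt_mem_nhds hε)
  filter_upwards [hev] with J hJ r hr
  obtain ⟨s, hs, hle⟩ := hS r hr J
  exact (mul_le_mul_of_nonneg_left hle (norm_nonneg _)).trans_lt (hJ s hs)

/-- Strict dominance at a point of `U` propagates to a neighbourhood in `U`. -/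
lemma eventually_dominant (f : LaceFun k U) {y : Fin n → PosReal} (hy : y ∈ U.carrier)
    {I : Fin n → ℤ} (h0 : f.coeff I ≠ 0)
    (h : ∀ J, J ≠ I → ‖f.coeff J‖ * (mon y J : ℝ) < ‖f.coeff I‖ * (mon y I : ℝ)) :
    ∀ᶠ r in 𝓝[U.carrier] y, ∀ J, J ≠ I →
      ‖f.coeff J‖ * (mon r J : ℝ) < ‖f.coeff I‖ * (mon r I : ℝ) := by
  obtain ⟨N, hN, hunif⟩ := f.exists_nhds_uniform hy
  have hpos := mul_pos (norm_pos_iff.2 h0) (mon_pos y I)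
  have hcont : ∀ J, Continuous fun r : Fin n → PosReal => ‖f.coeff J‖ * (mon r J : ℝ) :=
    fun J => continuous_const.mul (continuous_mon J)
  -- The threshold is half the dominant term at `y`. Near `y` the dominant term exceeds it, while
  -- all but finitely many other terms stay below it; continuity treats the finitely many left.
  have hfin := eventually_cofinite.1 (hunif _ (half_pos hpos))
  have h1 : ∀ᶠ r in 𝓝[U.carrier] y,
      ‖f.coeff I‖ * (mon y I : ℝ) / 2 < ‖f.coeff I‖ * (mon r I : ℝ) :=
    (((hcont I).tendsto y).eventually (lt_mem_nhds (half_lt_self hpos))).filter_mono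
      nhdsWithin_le_nhds
  have h2 : ∀ᶠ r in 𝓝[U.carrier] y, ∀ J ∈ hfin.toFinset, J ≠ I →
      ‖f.coeff J‖ * (mon r J : ℝ) < ‖f.coeff I‖ * (mon r I : ℝ) := by
    rw [Filter.eventually_all_finset]
    intro J _
    by_cases hJ : J = I
    · simp [hJ]
    · exact (((hcont J).tendsto y).eventually_lt ((hcont I).tendsto y) (h J hJ)).filter_mono
        nhdsWithin_le_nhds |>.mono fun r hr _ => hr
  filter_upwards [hN, h1, h2] with r hrN hr1 hr2 J hJ
  by_cases hJF : J ∈ hfin.toFinset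
  · exact hr2 J hJF hJ
  · rw [Set.Finite.mem_toFinset, Set.mem_ofPred_eq, not_not] at hJF
    exact (hJF r hrN).trans hr1

variable [IsUltrametricDist k] [CompleteSpace k]

/-- For a unit the argument uses the norm of `u * u⁻¹`, and so also covers `n = 0`. -/
lemma coeff_ne_zero_of_dominant_at (u : (LaceFun k U)ˣ) {r : Fin n → PosReal}
    (hr : r ∈ U.carrier) {I : Fin n → ℤ}
    (h : ∀ J, J ≠ I → ‖(u : LaceFun k U).coeff J‖ * (mon r J : ℝ) <
      ‖(u : LaceFun k U).coeff I‖ * (mon r I : ℝ)) : (u : LaceFun k U).coeff I ≠ 0 := by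
  intro h0
  rw [h0, norm_zero, zero_mul] at h
  have hle : gaussNorm r (u : LaceFun k U) ≤ 0 := gaussNorm_le fun J => by
    by_cases hJ : J = I
    · rw [hJ, h0, norm_zero, zero_mul]
    · exact (h J hJ).le
  have h1 := gaussNorm_mul (u : LaceFun k U) ((u⁻¹ : (LaceFun k U)ˣ) : LaceFun k U) hr
  rw [u.mul_inv, gaussNorm_one, le_antisymm hle (gaussNorm_nonneg _), zero_mul] at h1
  exact one_ne_zero h1

/-- An invertible function has a strictly dominant monomial, because `U` is connected. -/
lemma exists_hasStrictlyDominantMonomial (u : (LaceFun k U)ˣ) :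
    ∃ I, (u : LaceFun k U).HasStrictlyDominantMonomial I ∧ (u : LaceFun k U).coeff I ≠ 0 := by
  have hex : ∀ r : U.carrier, ∃ I, ∀ J, J ≠ I →
      ‖(u : LaceFun k U).coeff J‖ * (mon (r : Fin n → PosReal) J : ℝ) <
        ‖(u : LaceFun k U).coeff I‖ * (mon (r : Fin n → PosReal) I : ℝ) :=
    fun r => exists_dominant_at u r.2
  choose I hI using hex
  -- Near `y` both `I y` and `I r` are strictly dominant at `r`, so they agree.
  have hloc : IsLocallyConstant I := by
    rw [IsLocallyConstant.iff_eventually_eq]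
    intro y
    have := eventually_dominant (u : LaceFun k U) y.2
      (coeff_ne_zero_of_dominant_at u y.2 (hI y)) (hI y)
    rw [eventually_nhds_subtype_iff U.carrier y (fun r => ∀ J, J ≠ I y →
      ‖(u : LaceFun k U).coeff J‖ * (mon r J : ℝ) <
        ‖(u : LaceFun k U).coeff (I y)‖ * (mon r (I y) : ℝ)) |>.symm] at this
    filter_upwards [this] with r hr
    by_contra hne
    exact lt_asymm (hr _ hne) (hI r _ (Ne.symm hne))
  have := isPreconnected_iff_preconnectedSpace.1 U.isConnected.isPreconnected
  obtain ⟨y, hy⟩ := U.isConnected.nonempty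
  refine ⟨I ⟨y, hy⟩, fun r hr => ?_, coeff_ne_zero_of_dominant_at u hy (hI ⟨y, hy⟩)⟩
  rw [hloc.apply_eq_of_preconnectedSpace ⟨y, hy⟩ ⟨r, hr⟩]
  exact hI ⟨r, hr⟩

end LaceFun

end Dentelle

namespace Dentelle

/-! ### The degree of a unit and the lattice -/

namespace LaceFun

variable {k : Type*} [NormedField k] [IsUltrametricDist k] [CompleteSpace k] {n : ℕ}
  {U : LaceType n}

/-- The multidegree of the strictly dominant monomial of a unit. -/
def deg (u : (LaceFun k U)ˣ) : Fin n → ℤ := (exists_hasStrictlyDominantMonomial u).choose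

lemma deg_spec (u : (LaceFun k U)ˣ) : (u : LaceFun k U).HasStrictlyDominantMonomial (deg u) :=
  (exists_hasStrictlyDominantMonomial u).choose_spec.1

lemma coeff_deg_ne_zero (u : (LaceFun k U)ˣ) : (u : LaceFun k U).coeff (deg u) ≠ 0 :=
  (exists_hasStrictlyDominantMonomial u).choose_spec.2

lemma HasStrictlyDominantMonomial.deg_eq {u : (LaceFun k U)ˣ} {I : Fin n → ℤ}
    (h : (u : LaceFun k U).HasStrictlyDominantMonomial I) : deg u = I := (deg_spec u).eq h

lemma deg_unitSingle (I : Fin n → ℤ) (c : kˣ) : deg (unitSingle U I c) = I :=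
  (hasStrictlyDominantMonomial_single I c).deg_eq

lemma deg_mul (u v : (LaceFun k U)ˣ) : deg (u * v) = deg u + deg v :=
  HasStrictlyDominantMonomial.deg_eq
    ((deg_spec u).mul (deg_spec v) (coeff_deg_ne_zero u) (coeff_deg_ne_zero v))

lemma deg_eq_zero_of_sub_one_lt {u : (LaceFun k U)ˣ}
    (h : ∀ r ∈ U.carrier, gaussNorm r ((u : LaceFun k U) - 1) < 1) : deg u = 0 :=
  (hasStrictlyDominantMonomial_of_sub_lt (c := (1 : k)) fun r hr => by
    simpa [mon_zero, ← one_def] using h r hr).deg_eq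

variable (k U) in
/-- The multidegree as a homomorphism. -/
def degHom : (LaceFun k U)ˣ →* Multiplicative (Fin n → ℤ) :=
  MonoidHom.mk' (fun u => Multiplicative.ofAdd (deg u)) fun u v => by rw [deg_mul, ofAdd_add]

lemma degHom_apply (u : (LaceFun k U)ˣ) : degHom k U u = Multiplicative.ofAdd (deg u) := rfl

lemma degHom_surjective : Function.Surjective (degHom k U) := fun I =>
  ⟨unitSingle U I.toAdd 1, by rw [degHom_apply, deg_unitSingle, ofAdd_toAdd]⟩

lemma map_algebraMap_eq_unitSingle (c : kˣ) :
    Units.map (algebraMap k (LaceFun k U)).toMonoidHom c = unitSingle U 0 c := by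
  ext1
  rw [val_unitSingle, Units.coe_map]
  change algebraMap k (LaceFun k U) c = _
  rw [Algebra.algebraMap_eq_smul_one, one_def, smul_single, mul_one]

/-- A unit of degree `0` is `c(1+h)` with `c` its constant coefficient and `‖h‖_r < 1`, that is, `h`
topologically nilpotent. The converse is checked on generators. -/
lemma ker_degHom : (degHom k U).ker = dominatedUnits k U := by
  apply le_antisymm
  · intro u hu
    have hdeg : deg u = 0 := congrArg Multiplicative.toAdd (MonoidHom.mem_ker.1 hu)
    set c : kˣ := Units.mk0 _ (coeff_deg_ne_zero u) with hc
    have hs : ∀ r ∈ U.carrier, _ := fun r hr =>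
      (deg_spec u).gaussNorm_unitSingle_inv_mul_sub_one_lt c rfl hr
    rw [← mul_inv_cancel_left (unitSingle U (deg u) c) u]
    refine mul_mem (Subgroup.mem_sup_left ?_) (Subgroup.mem_sup_right (Subgroup.subset_closure ?_))
    · rw [hdeg]
      exact ⟨c, map_algebraMap_eq_unitSingle c⟩
    · exact isTopNilpotent_iff.2 hs
  · refine sup_le ?_ ((Subgroup.closure_le _).2 fun u hu => ?_)
    · rintro _ ⟨c, rfl⟩
      rw [MonoidHom.mem_ker, map_algebraMap_eq_unitSingle, degHom_apply, deg_unitSingle, ofAdd_zero]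
    · exact MonoidHom.mem_ker.2
        (congrArg Multiplicative.ofAdd (deg_eq_zero_of_sub_one_lt (isTopNilpotent_iff.1 hu)))

end LaceFun

open LaceFun

variable {k : Type*} [NormedField k] [IsUltrametricDist k] [CompleteSpace k] {n : ℕ}

variable (k) in
/-- The lattice of `D_U` is identified with `ℤⁿ` by the multidegree. -/
def latticeEquiv (U : LaceType n) : Lattice k U ≃+ (Fin n → ℤ) :=
  MulEquiv.toAdditiveLeft ((QuotientGroup.quotientMulEquivOfEq ker_degHom.symm).trans
    (QuotientGroup.quotientKerEquivOfSurjective (degHom k U) degHom_surjective))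

lemma latticeEquiv_mk {U : LaceType n} (u : (LaceFun k U)ˣ) :
    latticeEquiv k U (Lattice.mk u) = deg u := rfl

/-- The lattice of `D_U` has a `ℤ`-basis indexed by `Fin n`. -/
def latticeBasis (U : LaceType n) : Module.Basis (Fin n) ℤ (Lattice k U) :=
  (Pi.basisFun ℤ (Fin n)).map (latticeEquiv k U).symm.toIntLinearEquiv

lemma vecMul_eq_sum_smul {m : ℕ} (M : Matrix (Fin m) (Fin n) ℤ) (v : Fin m → ℤ) :
    Matrix.vecMul v M = ∑ i, v i • M i := by
  ext j
  simp [Matrix.vecMul, dotProduct]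

/-- Functions form a basis of the lattice if and only if they have strictly dominant monomials whose
multidegrees form an invertible matrix. -/
lemma exists_basis_iff {U : LaceType n} (f : Fin n → LaceFun k U) :
    (∃ M : Matrix.GeneralLinearGroup (Fin n) ℤ,
      ∀ i, (f i).HasStrictlyDominantMonomial ((M : Matrix (Fin n) (Fin n) ℤ) i)) ↔
    ∃ (u : Fin n → (LaceFun k U)ˣ) (b : Module.Basis (Fin n) ℤ (Lattice k U)),
      ∀ i, (u i : LaceFun k U) = f i ∧ b i = Lattice.mk (u i) := by
  constructor
  · rintro ⟨M, hM⟩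
    have hunit : ∀ i, IsUnit (f i) := fun i => (hM i).isUnit ((hM i).coeff_ne_zero i)
    -- The automorphism `v ↦ vM` of `ℤⁿ` sends the standard basis to the rows of `M`, that is, to
    -- the degrees of the `f i`.
    have hsurj : Function.Surjective (Matrix.vecMulLinear (M : Matrix (Fin n) (Fin n) ℤ)) :=
      Matrix.vecMul_surjective_iff_isUnit.2 M.isUnit
    have hbij : Function.Bijective (Matrix.vecMulLinear (M : Matrix (Fin n) (Fin n) ℤ)) :=
      ⟨Matrix.vecMul_injective_of_isUnit M.isUnit, hsurj⟩
    refine ⟨fun i => (hunit i).unit, ((Pi.basisFun ℤ (Fin n)).map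
      (LinearEquiv.ofBijective _ hbij)).map (latticeEquiv k U).symm.toIntLinearEquiv,
      fun i => ⟨rfl, ?_⟩⟩
    rw [Module.Basis.map_apply, Module.Basis.map_apply, AddEquiv.coe_toIntLinearEquiv,
      AddEquiv.symm_apply_eq, latticeEquiv_mk, Pi.basisFun_apply, LinearEquiv.ofBijective_apply,
      Matrix.vecMulLinear_apply, Matrix.single_one_vecMul]
    exact (HasStrictlyDominantMonomial.deg_eq (hM i)).symm
  · rintro ⟨u, b, hub⟩
    -- Only the spanning property of `b` is needed: a square integral matrix acting surjectively is
    -- invertible.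
    have hsurj : Function.Surjective fun v => Matrix.vecMul v (Matrix.of fun i => deg (u i)) := by
      intro I
      refine ⟨b.repr ((latticeEquiv k U).symm I), ?_⟩
      have h := congrArg (latticeEquiv k U) (b.sum_repr ((latticeEquiv k U).symm I))
      rw [AddEquiv.apply_symm_apply, map_sum] at h
      refine (vecMul_eq_sum_smul _ _).trans (Eq.trans ?_ h)
      refine Finset.sum_congr rfl fun i _ => ?_
      rw [map_zsmul, (hub i).2, latticeEquiv_mk]
      rfl
    refine ⟨(Matrix.vecMul_surjective_iff_isUnit.1 hsurj).unit, fun i => ?_⟩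
    rw [← (hub i).1]
    exact deg_spec (u i)

end Dentelle

namespace Dentelle

/-! ### Evaluation at the points of `D_U` -/

variable {k : Type*} [NormedField k] {n : ℕ} {U : LaceType n}

lemma mem_domain {x : TorusPoint k n} : x ∈ domain k U ↔ x.radius ∈ U.carrier := Iff.rfl

lemma TorusPoint.continuous_val (p : LaurentPoly k n) :
    Continuous fun x : TorusPoint k n => x.val p :=
  (continuous_apply p).comp continuous_induced_dom

lemma TorusPoint.continuous_radius : Continuous (TorusPoint.radius (k := k) (n := n)) :=
  continuous_pi fun _ => continuous_induced_rng.2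
    (NNReal.continuous_coe.comp (TorusPoint.continuous_val _))

lemma TorusPoint.ext_val {x y : TorusPoint k n} (h : ∀ p, x.val p = y.val p) : x = y := by
  obtain ⟨v, _⟩ := x
  obtain ⟨w, _⟩ := y
  obtain rfl : v = w := Valuation.ext h
  rfl

lemma TorusPoint.dist_val_le (x : TorusPoint k n) (p q : LaurentPoly k n) :
    |(x.val p : ℝ) - x.val q| ≤ x.val (p - q) := by
  rw [abs_sub_le_iff, sub_le_iff_le_add, sub_le_iff_le_add]
  constructor
  · have := x.val.map_add (p - q) q
    rw [sub_add_cancel] at this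
    exact_mod_cast this.trans (max_le_add_of_nonneg zero_le zero_le)
  · have := x.val.map_sub p (p - q)
    rw [sub_sub_cancel] at this
    rw [add_comm]
    exact_mod_cast this.trans (max_le_add_of_nonneg zero_le zero_le)

namespace LaceFun

lemma mon_single_one (r : Fin n → PosReal) (i : Fin n) : mon r (Pi.single i 1) = r i := by
  rw [mon, Finset.prod_eq_single i]
  · simp
  · intro j _ hj; simp [hj]
  · simp

/-- An upper bound for `T^{-I}` is a lower bound for `T^I`, so one-sided estimates on all monomials
suffice. -/
lemma _root_.Dentelle.TorusPoint.radius_eq_of_val_monomialT_le (x : TorusPoint k n)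
    {s : Fin n → PosReal}
    (h : ∀ I, (x.val (monomialT I) : ℝ) ≤ mon s I) : x.radius = s := by
  ext i
  rw [← mon_single_one x.radius, ← mon_single_one s]
  refine le_antisymm (x.val_monomialT _ ▸ h _) ?_
  have h2 := h (-Pi.single i 1)
  rw [x.val_monomialT] at h2
  have e : ∀ t : Fin n → PosReal, mon t (-Pi.single i 1) = (mon t (Pi.single i 1))⁻¹ :=
    fun t => by simp [mon]
  rw [e, e, Subtype.coe_le_coe, inv_le_inv_iff] at h2
  exact h2

lemma val_partialSum_le (f : LaceFun k U) {x : TorusPoint k n} (hx : x ∈ domain k U)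
    (F : Finset (Fin n → ℤ)) : (x.val (f.partialSum F) : ℝ) ≤ gaussNorm x.radius f := by
  obtain ⟨δ, hδ⟩ : ∃ δ : ℝ≥0, (δ : ℝ) = gaussNorm x.radius f := ⟨⟨_, gaussNorm_nonneg f⟩, rfl⟩
  rw [← hδ, NNReal.coe_le_coe]
  refine Valuation.map_sum_le _ fun I _ => ?_
  rw [← NNReal.coe_le_coe, x.val_single, hδ]
  exact f.le_gaussNorm hx I

variable [IsUltrametricDist k] [CompleteSpace k]

variable (k U) in
/-- Laurent polynomials as analytic functions on `D_U`. -/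
def ofLaurent : LaurentPoly k n →ₐ[k] LaceFun k U :=
  AddMonoidAlgebra.lift k (LaceFun k U) (Fin n → ℤ)
    { toFun := fun I => single I.toAdd 1
      map_one' := rfl
      map_mul' := fun I J => by rw [single_mul_single, one_mul, toAdd_mul] }

lemma ofLaurent_single (I : Fin n → ℤ) (c : k) :
    ofLaurent k U (AddMonoidAlgebra.single I c) = single I c := by
  rw [ofLaurent, AddMonoidAlgebra.lift_single, MonoidHom.coe_mk, OneHom.coe_mk, smul_single,
    mul_one, toAdd_ofAdd]

lemma ofLaurent_partialSum (f : LaceFun k U) (F : Finset (Fin n → ℤ)) :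
    ofLaurent k U (f.partialSum F) = ∑ I ∈ F, single I (f.coeff I) := by
  rw [partialSum, map_sum]
  exact Finset.sum_congr rfl fun I _ => ofLaurent_single I _

lemma coeff_sub_ofLaurent_partialSum (f : LaceFun k U) (F : Finset (Fin n → ℤ)) (J)
    [Decidable (J ∈ F)] :
    (f - ofLaurent k U (f.partialSum F)).coeff J = if J ∈ F then 0 else f.coeff J := by
  have : ∀ I ∈ F, I ≠ J → (single I (f.coeff I) : LaceFun k U).coeff J = 0 :=
    fun I _ hI => coeff_single_ne hI.symm _
  rw [coeff_sub, ofLaurent_partialSum, coeff_sum]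
  split_ifs with hJ
  · rw [Finset.sum_eq_single_of_mem J hJ this, coeff_single_same, sub_self]
  · rw [Finset.sum_eq_zero fun I hI => this I hI (by rintro rfl; exact hJ hI), sub_zero]

lemma gaussNorm_sub_partialSum_le (f : LaceFun k U) (F : Finset (Fin n → ℤ))
    {r : Fin n → PosReal} {C : ℝ} (hC : 0 ≤ C)
    (h : ∀ J ∉ F, ‖f.coeff J‖ * (mon r J : ℝ) ≤ C) :
    gaussNorm r (f - ofLaurent k U (f.partialSum F)) ≤ C := by
  classical
  refine gaussNorm_le fun J => ?_
  rw [coeff_sub_ofLaurent_partialSum]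
  split_ifs with hJ
  · simpa using hC
  · exact h J hJ

lemma tendsto_gaussNorm_sub_partialSum (f : LaceFun k U) {r : Fin n → PosReal}
    (hr : r ∈ U.carrier) :
    Tendsto (fun F => gaussNorm r (f - ofLaurent k U (f.partialSum F))) atTop (𝓝 0) := by
  rw [Metric.tendsto_nhds]
  intro ε hε
  have hfin := eventually_cofinite.1 ((f.tendsto hr).eventually (gt_mem_nhds (half_pos hε)))
  filter_upwards [eventually_ge_atTop hfin.toFinset] with F hF
  rw [Real.dist_eq, sub_zero, abs_of_nonneg (gaussNorm_nonneg _)]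
  refine (f.gaussNorm_sub_partialSum_le F (half_pos hε).le fun J hJ => ?_).trans_lt
    (half_lt_self hε)
  by_contra h
  exact hJ (hF (hfin.mem_toFinset.2 fun h' => h h'.le))

lemma absAt_le (f : LaceFun k U) {x : TorusPoint k n} (hx : x ∈ domain k U) :
    (f.absAt x : ℝ) ≤ gaussNorm x.radius f :=
  le_of_tendsto ((NNReal.continuous_coe.tendsto _).comp (f.tendsto_absAt hx))
    (Eventually.of_forall fun F => f.val_partialSum_le hx F)

lemma partialSum_ofLaurent (p : LaurentPoly k n) :
    ∀ᶠ F in atTop, (ofLaurent k U p).partialSum F = p := by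
  have hadd : ∀ (f g : LaceFun k U) F, (f + g).partialSum F = f.partialSum F + g.partialSum F :=
    fun f g F => by simp [partialSum, Finset.sum_add_distrib]
  have hsmul : ∀ (c : k) (f : LaceFun k U) F, (c • f).partialSum F = c • f.partialSum F :=
    fun c f F => by simp [partialSum, Finset.smul_sum]
  induction p using AddMonoidAlgebra.induction_on with
  | of I =>
    filter_upwards [eventually_ge_atTop ({I} : Finset (Fin n → ℤ))] with F hF
    rw [AddMonoidAlgebra.of_apply, toAdd_ofAdd, ofLaurent_single, partialSum,
      Finset.sum_eq_single_of_mem _ (hF (Finset.mem_singleton_self _)), coeff_single_same]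
    intro J _ hJ
    rw [coeff_single_ne hJ, AddMonoidAlgebra.single_zero]
  | add p q hp hq =>
    filter_upwards [hp, hq] with F h1 h2
    rw [map_add, hadd, h1, h2]
  | smul c p hp =>
    filter_upwards [hp] with F h1
    rw [map_smul, hsmul, h1]

lemma absAt_ofLaurent (p : LaurentPoly k n) {x : TorusPoint k n} (hx : x ∈ domain k U) :
    (ofLaurent k U p).absAt x = x.val p := by
  refine tendsto_nhds_unique ((ofLaurent k U p).tendsto_absAt hx) ?_
  refine tendsto_const_nhds.congr' ?_
  filter_upwards [partialSum_ofLaurent (U := U) p] with F hF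
  rw [hF]

lemma dist_val_absAt_le (f : LaceFun k U) {x : TorusPoint k n} (hx : x ∈ domain k U)
    (p : LaurentPoly k n) :
    |(f.absAt x : ℝ) - x.val p| ≤ gaussNorm x.radius (f - ofLaurent k U p) := by
  have h1 : Tendsto (fun F => |(x.val (f.partialSum F) : ℝ) - x.val p|) atTop
      (𝓝 |(f.absAt x : ℝ) - x.val p|) :=
    (((NNReal.continuous_coe.tendsto _).comp (f.tendsto_absAt hx)).sub_const _).abs
  have h2 : Tendsto (fun F => gaussNorm x.radius (f - ofLaurent k U (f.partialSum F)) +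
      gaussNorm x.radius (f - ofLaurent k U p)) atTop
      (𝓝 (0 + gaussNorm x.radius (f - ofLaurent k U p))) :=
    (f.tendsto_gaussNorm_sub_partialSum hx).add_const _
  rw [zero_add] at h2
  refine le_of_tendsto_of_tendsto' h1 h2 fun F => (x.dist_val_le _ _).trans ?_
  have h3 := absAt_le (ofLaurent k U (f.partialSum F - p)) hx
  rw [absAt_ofLaurent _ hx, map_sub (ofLaurent k U)] at h3
  refine h3.trans ?_
  have e : ofLaurent k U (f.partialSum F) - ofLaurent k U p =
      (f - ofLaurent k U p) - (f - ofLaurent k U (f.partialSum F)) := by abel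
  rw [e, add_comm]
  exact (gaussNorm_sub_le _ _ hx).trans
    (max_le_add_of_nonneg (gaussNorm_nonneg _) (gaussNorm_nonneg _))

/-- Frees `|f(x)|` from the choice of partial sums. Products need this, since a product of partial
sums is not a partial sum of the product. -/
lemma tendsto_val_of_tendsto_gaussNorm {ι : Type*} {l : Filter ι} (f : LaceFun k U)
    {x : TorusPoint k n} (hx : x ∈ domain k U) {p : ι → LaurentPoly k n}
    (h : Tendsto (fun i => gaussNorm x.radius (f - ofLaurent k U (p i))) l (𝓝 0)) :
    Tendsto (fun i => x.val (p i)) l (𝓝 (f.absAt x)) := by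
  rw [← NNReal.tendsto_coe, tendsto_iff_dist_tendsto_zero]
  refine squeeze_zero (fun _ => dist_nonneg) (fun i => ?_) h
  rw [dist_comm, Real.dist_eq]
  exact f.dist_val_absAt_le hx _

lemma absAt_mul (f g : LaceFun k U) {x : TorusPoint k n} (hx : x ∈ domain k U) :
    (f * g).absAt x = f.absAt x * g.absAt x := by
  have h := (f.tendsto_absAt hx).mul (g.tendsto_absAt hx)
  refine tendsto_nhds_unique (tendsto_val_of_tendsto_gaussNorm (f * g) hx
    (p := fun F => f.partialSum F * g.partialSum F) ?_) (by simpa using h)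
  have hf := f.tendsto_gaussNorm_sub_partialSum hx
  have hg := g.tendsto_gaussNorm_sub_partialSum hx
  have hb := ((hf.mul_const (gaussNorm x.radius g)).add (hg.const_mul (gaussNorm x.radius f))).add
    (hf.mul hg)
  simp only [zero_mul, mul_zero, add_zero] at hb
  refine squeeze_zero (fun _ => gaussNorm_nonneg _) (fun F => ?_) hb
  rw [map_mul]
  set p := ofLaurent k U (f.partialSum F)
  set q := ofLaurent k U (g.partialSum F)
  have e : f * g - p * q = ((f - p) * g + f * (g - q)) - (f - p) * (g - q) := by ring
  rw [e, ← gaussNorm_mul _ _ hx, ← gaussNorm_mul _ _ hx, ← gaussNorm_mul _ _ hx]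
  refine (gaussNorm_sub_le _ _ hx).trans ((max_le_add_of_nonneg (gaussNorm_nonneg _)
    (gaussNorm_nonneg _)).trans (add_le_add_left ?_ _))
  exact (gaussNorm_add_le _ _ hx).trans (max_le_add_of_nonneg (gaussNorm_nonneg _)
    (gaussNorm_nonneg _))

lemma absAt_add_le (f g : LaceFun k U) {x : TorusPoint k n} (hx : x ∈ domain k U) :
    (f + g).absAt x ≤ max (f.absAt x) (g.absAt x) := by
  refine le_of_tendsto_of_tendsto' ((f + g).tendsto_absAt hx)
    ((f.tendsto_absAt hx).max (g.tendsto_absAt hx)) fun F => ?_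
  have : (f + g).partialSum F = f.partialSum F + g.partialSum F := by
    simp [partialSum, Finset.sum_add_distrib]
  rw [this]
  exact x.val.map_add _ _

/-- The absolute value at a point of `D_U`, as a valuation on `A_U`. -/
def absVal (x : TorusPoint k n) (hx : x ∈ domain k U) : Valuation (LaceFun k U) ℝ≥0 where
  toFun f := f.absAt x
  map_zero' := by
    have := absAt_ofLaurent (U := U) 0 hx
    rwa [map_zero, map_zero] at this
  map_one' := by
    have := absAt_ofLaurent (U := U) 1 hx
    rwa [map_one, map_one] at this
  map_mul' f g := absAt_mul f g hx
  map_add_le_max' f g := absAt_add_le f g hx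

lemma absVal_apply {x : TorusPoint k n} (hx : x ∈ domain k U) (f : LaceFun k U) :
    absVal x hx f = f.absAt x := rfl

/-- The function `x ↦ |f(x)|` is continuous on `D_U`. -/
lemma continuous_absAt (f : LaceFun k U) : Continuous fun x : domain k U => f.absAt x.1 := by
  rw [continuous_iff_continuousAt]
  intro x
  refine continuousAt_of_locally_uniform_approx_of_continuousAt fun u hu => ?_
  obtain ⟨ε, hε, hεu⟩ := Metric.mem_uniformity_dist.1 hu
  obtain ⟨N, hN, hunif⟩ := f.exists_nhds_uniform x.2
  -- One finite partial sum approximates `f` uniformly over all points with radius in `N`.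
  have hfin := eventually_cofinite.1 (hunif (ε / 2) (half_pos hε))
  have hcont : Continuous fun y : domain k U => y.1.radius :=
    TorusPoint.continuous_radius.comp continuous_subtype_val
  have htend : Tendsto (fun y : domain k U => y.1.radius) (𝓝 x) (𝓝[U.carrier] x.1.radius) :=
    tendsto_nhdsWithin_iff.2 ⟨hcont.tendsto x, Eventually.of_forall fun y => y.2⟩
  refine ⟨_, htend hN, fun y => y.1.val (f.partialSum hfin.toFinset),
    ((TorusPoint.continuous_val _).comp continuous_subtype_val).continuousAt, fun y hy => hεu ?_⟩
  rw [NNReal.dist_eq]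
  refine (f.dist_val_absAt_le y.2 _).trans_lt (lt_of_le_of_lt ?_ (half_lt_self hε))
  refine f.gaussNorm_sub_partialSum_le _ (half_pos hε).le fun J hJ => ?_
  rw [Set.Finite.mem_toFinset, Set.mem_ofPred_eq, not_not] at hJ
  exact (hJ _ hy).le

/-! ### Gauss points -/

/-- The Gauss norm as a valuation. -/
def gaussVal (r : Fin n → PosReal) (hr : r ∈ U.carrier) : Valuation (LaceFun k U) ℝ≥0 where
  toFun f := ⟨gaussNorm r f, gaussNorm_nonneg _⟩
  map_zero' := NNReal.eq gaussNorm_zero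
  map_one' := NNReal.eq gaussNorm_one
  map_mul' f g := NNReal.eq (gaussNorm_mul f g hr)
  map_add_le_max' f g := gaussNorm_add_le f g hr

variable (k) in
/-- The point `η_r`. -/
def gaussPoint (r : Fin n → PosReal) (hr : r ∈ U.carrier) : TorusPoint k n where
  val := (gaussVal (k := k) r hr).comap (ofLaurent k U).toRingHom
  val_const c := NNReal.eq <| by
    change gaussNorm r (ofLaurent k U (AddMonoidAlgebra.single 0 c)) = ‖c‖
    rw [ofLaurent_single, gaussNorm_single, mon_zero, Positive.val_one, mul_one]

lemma val_gaussPoint {r : Fin n → PosReal} (hr : r ∈ U.carrier) (p : LaurentPoly k n) :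
    ((gaussPoint k r hr).val p : ℝ) = gaussNorm r (ofLaurent k U p) := rfl

lemma radius_gaussPoint {r : Fin n → PosReal} (hr : r ∈ U.carrier) :
    (gaussPoint k r hr).radius = r := by
  ext i
  change ((gaussPoint k r hr).val (monomialT (Pi.single i 1)) : ℝ) = r i
  rw [val_gaussPoint, monomialT, ofLaurent_single, gaussNorm_single, norm_one, one_mul,
    mon_single_one]

lemma gaussPoint_mem {r : Fin n → PosReal} (hr : r ∈ U.carrier) :
    gaussPoint k r hr ∈ domain k U := by
  rwa [mem_domain, radius_gaussPoint]

/-- Since `‖·‖_r` is evaluation at a point of `D_U`, identities between absolute values at points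
yield estimates of norms. -/
lemma absAt_gaussPoint (f : LaceFun k U) {r : Fin n → PosReal} (hr : r ∈ U.carrier) :
    (f.absAt (gaussPoint k r hr) : ℝ) = gaussNorm r f := by
  refine tendsto_nhds_unique ((NNReal.continuous_coe.tendsto _).comp
    (f.tendsto_absAt (gaussPoint_mem hr))) ?_
  rw [tendsto_iff_dist_tendsto_zero]
  refine squeeze_zero (fun _ => dist_nonneg) (fun F => ?_) (f.tendsto_gaussNorm_sub_partialSum hr)
  rw [Function.comp_apply, val_gaussPoint, Real.dist_eq, abs_sub_le_iff, sub_le_iff_le_add,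
    sub_le_iff_le_add]
  constructor
  · have := gaussNorm_sub_le f (f - ofLaurent k U (f.partialSum F)) hr
    rw [sub_sub_cancel] at this
    rw [add_comm]
    exact this.trans (max_le_add_of_nonneg (gaussNorm_nonneg _) (gaussNorm_nonneg _))
  · have := gaussNorm_add_le (f - ofLaurent k U (f.partialSum F))
      (ofLaurent k U (f.partialSum F)) hr
    rw [sub_add_cancel] at this
    exact this.trans (max_le_add_of_nonneg (gaussNorm_nonneg _) (gaussNorm_nonneg _))

end LaceFun

end Dentelle

namespace Dentelle

open LaceFun

variable {k : Type*} [NormedField k] [IsUltrametricDist k] [CompleteSpace k] {n : ℕ}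
  {U V : LaceType n}

/-! ### Coordinate systems have strictly dominant monomials -/

/-- `‖φ^* g‖_r = |g(φ(η_r))| ≤ ‖g‖_s`, where `s ∈ V` is the radius of `φ(η_r)`. -/
lemma LaceHom.gaussNorm_globalPullback_lt_one (φ : LaceHom k U V) {g : LaceFun k V}
    (hg : ∀ s ∈ V.carrier, gaussNorm s g < 1) {r : Fin n → PosReal} (hr : r ∈ U.carrier) :
    gaussNorm r (φ.globalPullback g) < 1 := by
  have h := φ.absAt_pullback U V subset_rfl subset_rfl (fun x _ => (φ.toFun x).2) g
    ⟨gaussPoint k r hr, gaussPoint_mem hr⟩ (gaussPoint_mem hr)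
  rw [← absAt_gaussPoint _ hr]
  change ((φ.globalPullback g).absAt (gaussPoint k r hr) = _) at h
  rw [h]
  exact (absAt_le g (φ.toFun _).2).trans_lt (hg _ (φ.toFun _).2)

/-- In `v = T^{deg v} · c · (1+h)`, the pullbacks of `c` and `1+h` have degree `0`. So the degree of
`φ^* v` depends only on that of `v`. -/
lemma LaceHom.deg_map_globalPullback (φ : LaceHom k U V) (v : (LaceFun k V)ˣ) :
    deg (Units.map φ.globalPullback.toMonoidHom v) =
      deg (Units.map φ.globalPullback.toMonoidHom (unitSingle V (deg v) 1)) := by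
  set c : kˣ := Units.mk0 _ (coeff_deg_ne_zero v)
  have hs : ∀ s ∈ V.carrier, _ := fun s hs =>
    (deg_spec v).gaussNorm_unitSingle_inv_mul_sub_one_lt c rfl hs
  have e : v = unitSingle V (deg v) 1 * unitSingle V 0 c * ((unitSingle V (deg v) c)⁻¹ * v) := by
    rw [unitSingle_mul, add_zero, one_mul, mul_inv_cancel_left]
  have hconst : Units.map φ.globalPullback.toMonoidHom (unitSingle V 0 c) = unitSingle U 0 c := by
    rw [← map_algebraMap_eq_unitSingle, ← map_algebraMap_eq_unitSingle]
    ext1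
    exact φ.globalPullback.commutes c
  have hone : deg (Units.map φ.globalPullback.toMonoidHom
      ((unitSingle V (deg v) c)⁻¹ * v)) = 0 := by
    refine deg_eq_zero_of_sub_one_lt fun r hr => ?_
    have := φ.gaussNorm_globalPullback_lt_one hs hr
    rwa [map_sub, map_one] at this
  conv_lhs => rw [e, map_mul, map_mul, deg_mul, deg_mul, hone, hconst, deg_unitSingle, add_zero,
    add_zero]

lemma IsCoordinateSystem.exists_generalLinearGroup {f : Fin n → LaceFun k U}
    (hf : IsCoordinateSystem f) : ∃ M : Matrix.GeneralLinearGroup (Fin n) ℤ,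
      ∀ i, (f i).HasStrictlyDominantMonomial ((M : Matrix (Fin n) (Fin n) ℤ) i) := by
  obtain ⟨V, φ, hφ, hφf⟩ := hf
  have hbij : Function.Bijective φ.globalPullback :=
    hφ.2 U V subset_rfl subset_rfl fun x => iff_of_true x.2 (φ.toFun x).2
  let D : (Fin n → ℤ) →+ (Fin n → ℤ) := AddMonoidHom.mk'
    (fun J => deg (Units.map φ.globalPullback.toMonoidHom (unitSingle V J 1))) fun I J => by
      rw [← deg_mul, ← map_mul, unitSingle_mul, one_mul]
  have hD : ∀ J, Matrix.vecMul J (Matrix.of fun i => D (Pi.single i 1)) = D J := by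
    intro J
    rw [vecMul_eq_sum_smul]
    conv_rhs => rw [← Finset.univ_sum_single J, map_sum]
    refine Finset.sum_congr rfl fun i _ => ?_
    change J i • D (Pi.single i 1) = _
    rw [← map_zsmul, ← Pi.single_smul, smul_eq_mul, mul_one]
  -- The unit `T^I` of `A_U` is the pullback of some unit `v`, and `D (deg v) = I`.
  have hsurj : Function.Surjective
      fun J => Matrix.vecMul J (Matrix.of fun i => D (Pi.single i 1)) := by
    intro I
    let e := Units.mapEquiv (AlgEquiv.ofBijective φ.globalPullback hbij).toMulEquiv
    obtain ⟨v, hv⟩ := e.surjective (unitSingle U I 1)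
    refine ⟨deg v, (hD _).trans ?_⟩
    have h1 : Units.map φ.globalPullback.toMonoidHom v = unitSingle U I 1 := by
      rw [← hv]; rfl
    have h2 := φ.deg_map_globalPullback v
    rw [h1, deg_unitSingle] at h2
    exact h2.symm
  refine ⟨(Matrix.vecMul_surjective_iff_isUnit.1 hsurj).unit, fun i => ?_⟩
  rw [← hφf i]
  exact deg_spec (Units.map φ.globalPullback.toMonoidHom (unitSingle V (Pi.single i 1) 1))

end Dentelle

namespace Dentelle

/-! ### Monomial automorphisms of `(ℝ₊^×)ⁿ` -/

variable {n : ℕ}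

lemma mon_mul (r s : Fin n → PosReal) (J : Fin n → ℤ) :
    mon (r * s) J = mon r J * mon s J := by
  simp [mon, mul_zpow, Finset.prod_mul_distrib]

lemma mon_inv (r : Fin n → PosReal) (J : Fin n → ℤ) : mon r⁻¹ J = (mon r J)⁻¹ := by
  simp [mon]

lemma mon_sum {ι : Type*} (r : Fin n → PosReal) (s : Finset ι) (J : ι → Fin n → ℤ) :
    mon r (∑ i ∈ s, J i) = ∏ i ∈ s, mon r (J i) := by
  classical
  induction s using Finset.induction_on with
  | empty => rw [Finset.sum_empty, Finset.prod_empty, mon_zero]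
  | insert a s ha ih => rw [Finset.sum_insert ha, Finset.prod_insert ha, mon_add, ih]

lemma mon_zsmul (r : Fin n → PosReal) (a : ℤ) (J : Fin n → ℤ) : mon r (a • J) = mon r J ^ a := by
  simp [mon, zpow_mul', Finset.prod_zpow]

lemma mon_mon (r : Fin n → PosReal) (A : Matrix (Fin n) (Fin n) ℤ) (J : Fin n → ℤ) :
    mon (fun i => mon r (A i)) J = mon r (Matrix.vecMul J A) := by
  rw [vecMul_eq_sum_smul, mon_sum]
  exact Finset.prod_congr rfl fun i _ => (mon_zsmul _ _ _).symm

/-- The map `r ↦ (cᵢ r^{Aᵢ})ᵢ`. -/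
def monMap (c : Fin n → PosReal) (A : Matrix (Fin n) (Fin n) ℤ) (r : Fin n → PosReal) :
    Fin n → PosReal := fun i => c i * mon r (A i)

lemma mon_monMap (c : Fin n → PosReal) (A : Matrix (Fin n) (Fin n) ℤ) (r : Fin n → PosReal)
    (J : Fin n → ℤ) : mon (monMap c A r) J = mon c J * mon r (Matrix.vecMul J A) := by
  rw [← mon_mon, ← mon_mul]; rfl

lemma continuous_monMap (c : Fin n → PosReal) (A : Matrix (Fin n) (Fin n) ℤ) :
    Continuous (monMap c A) :=
  continuous_pi fun i => IsZAffine.continuous ⟨c i, A i, fun _ => rfl⟩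

lemma IsZAffine.comp_monMap {φ : (Fin n → PosReal) → PosReal} (h : IsZAffine φ)
    (c : Fin n → PosReal) (A : Matrix (Fin n) (Fin n) ℤ) : IsZAffine (φ ∘ monMap c A) := by
  obtain ⟨r, a, h⟩ := h
  refine ⟨r * mon c a, Matrix.vecMul a A, fun t => ?_⟩
  rw [Function.comp_apply, h, mon_monMap, mul_assoc]

lemma vecMul_row_of_mul_eq_one {A B : Matrix (Fin n) (Fin n) ℤ} (h : A * B = 1) (i : Fin n) :
    Matrix.vecMul (A i) B = Pi.single i 1 := by
  ext j
  rw [show Matrix.vecMul (A i) B j = (A * B) i j from rfl, h, Matrix.one_apply, Pi.single_apply]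
  exact if_congr eq_comm rfl rfl

/-- The affine automorphism `r ↦ (cᵢ r^{Mᵢ})ᵢ` of `(ℝ₊^×)ⁿ` given by an invertible matrix. -/
def monHomeo (c : Fin n → PosReal) (M : Matrix.GeneralLinearGroup (Fin n) ℤ) :
    (Fin n → PosReal) ≃ₜ (Fin n → PosReal) where
  toFun := monMap c M
  -- Raising `(cⱼ r^{Mⱼ})ⱼ` to the exponent given by row `i` of `M⁻¹` gives `rᵢ` times that power of
  -- `c`, which the constant cancels.
  invFun := monMap (fun i => (mon c ((M⁻¹ : Matrix.GeneralLinearGroup (Fin n) ℤ).1 i))⁻¹)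
    (M⁻¹ : Matrix.GeneralLinearGroup (Fin n) ℤ).1
  left_inv r := by
    ext1 i
    have : Matrix.vecMul ((M⁻¹ : Matrix.GeneralLinearGroup (Fin n) ℤ).1 i) M.1 = Pi.single i 1 :=
      vecMul_row_of_mul_eq_one (by rw [← Units.val_mul, inv_mul_cancel, Units.val_one]) i
    change _ * mon (monMap c M r) _ = _
    rw [mon_monMap, inv_mul_cancel_left, this, LaceFun.mon_single_one]
  right_inv r := by
    ext1 i
    have : Matrix.vecMul (M.1 i) (M⁻¹ : Matrix.GeneralLinearGroup (Fin n) ℤ).1 = Pi.single i 1 :=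
      vecMul_row_of_mul_eq_one (by rw [← Units.val_mul, mul_inv_cancel, Units.val_one]) i
    change c i * mon (monMap _ _ r) (M.1 i) = _
    rw [mon_monMap, this, LaceFun.mon_single_one]
    have h2 := mon_inv (fun i => mon c ((M⁻¹ : Matrix.GeneralLinearGroup (Fin n) ℤ).1 i)) (M.1 i)
    rw [mon_mon, this, LaceFun.mon_single_one] at h2
    change c i * (mon (fun i => mon c ((M⁻¹ : Matrix.GeneralLinearGroup (Fin n) ℤ).1 i))⁻¹ (M.1 i)
      * r i) = r i
    rw [h2, mul_inv_cancel_left]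
  continuous_toFun := continuous_monMap _ _
  continuous_invFun := continuous_monMap _ _

lemma IsZPolytope.image_monHomeo {P : Set (Fin n → PosReal)} (hP : IsZPolytope P)
    (c : Fin n → PosReal) (M : Matrix.GeneralLinearGroup (Fin n) ℤ) :
    IsZPolytope (monHomeo c M '' P) := by
  obtain ⟨hcomp, p, q, φ, hφ, rfl⟩ := hP
  refine ⟨hcomp.image (monHomeo c M).continuous, p, q, fun i j => φ i j ∘ (monHomeo c M).symm,
    fun i j => (hφ i j).comp_monMap _ _, ?_⟩
  rw [Homeomorph.image_eq_preimage_symm]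
  rfl

lemma IsPiecewiseZLinear.image_monHomeo {U : Set (Fin n → PosReal)} (hU : IsPiecewiseZLinear U)
    (c : Fin n → PosReal) (M : Matrix.GeneralLinearGroup (Fin n) ℤ) :
    IsPiecewiseZLinear (monHomeo c M '' U) := by
  obtain ⟨𝒮, hpoly, hsub, hcov⟩ := hU
  refine ⟨Set.image (monHomeo c M) '' 𝒮, ?_, ?_, ?_⟩
  · rintro _ ⟨P, hP, rfl⟩
    exact (hpoly P hP).image_monHomeo c M
  · rintro _ ⟨P, hP, rfl⟩
    exact Set.image_mono (hsub P hP)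
  · rintro _ ⟨y, hy, rfl⟩
    obtain ⟨F, hFfin, hF, hyF, hN⟩ := hcov y hy
    refine ⟨Set.image (monHomeo c M) '' F, hFfin.image _, Set.image_mono hF, ?_, ?_⟩
    · rintro _ ⟨P, hP, rfl⟩
      exact Set.mem_image_of_mem _ (hyF P hP)
    · rw [← (monHomeo c M).isEmbedding.map_nhdsWithin_eq, ← Set.image_sUnion]
      exact image_mem_map hN

/-- The image of a type of laces under a monomial automorphism. -/
def LaceType.map (U : LaceType n) (c : Fin n → PosReal)
    (M : Matrix.GeneralLinearGroup (Fin n) ℤ) : LaceType n where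
  carrier := monHomeo c M '' U.carrier
  isPiecewiseZLinear := U.isPiecewiseZLinear.image_monHomeo c M
  isConnected := U.isConnected.image _ (monHomeo c M).continuous.continuousOn

end Dentelle

namespace Dentelle

namespace LaceFun

variable {k : Type*} [NormedField k] [IsUltrametricDist k] [CompleteSpace k] {n : ℕ}
  {U P Q : LaceType n} {r : Fin n → PosReal}

/-! ### Substitution of invertible functions into Laurent series -/

lemma gaussNorm_unit_pos (u : (LaceFun k U)ˣ) (hr : r ∈ U.carrier) :
    0 < gaussNorm r (u : LaceFun k U) := by
  rw [(deg_spec u).gaussNorm_eq hr]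
  exact mul_pos (norm_pos_iff.2 (coeff_deg_ne_zero u)) (mon_pos _ _)

/-- The Gauss norm on the group of units. -/
def unitNorm (r : Fin n → PosReal) (hr : r ∈ U.carrier) : (LaceFun k U)ˣ →* PosReal :=
  MonoidHom.mk' (fun u => ⟨gaussNorm r (u : LaceFun k U), gaussNorm_unit_pos u hr⟩) fun _ _ =>
    Subtype.ext (gaussNorm_mul _ _ hr)

lemma val_unitNorm (hr : r ∈ U.carrier) (u : (LaceFun k U)ˣ) :
    (unitNorm r hr u : ℝ) = gaussNorm r (u : LaceFun k U) := rfl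

/-- The leading coefficient of a unit. -/
def lead (u : (LaceFun k U)ˣ) : kˣ := Units.mk0 _ (coeff_deg_ne_zero u)

/-- The absolute values of the leading coefficients of a family of units. -/
def leadNorm (u : Fin n → (LaceFun k U)ˣ) (i : Fin n) : PosReal :=
  ⟨‖(lead (u i) : k)‖, norm_pos_iff.2 (lead (u i)).ne_zero⟩

/-- The matrix of the multidegrees of a family of units. -/
def degMatrix (u : Fin n → (LaceFun k U)ˣ) : Matrix (Fin n) (Fin n) ℤ := fun i => deg (u i)

/-- The monomial map that describes the absolute values of a family of units. -/
def absMap (u : Fin n → (LaceFun k U)ˣ) : (Fin n → PosReal) → Fin n → PosReal :=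
  monMap (leadNorm u) (degMatrix u)

/-- The monomial `u^J = ∏ uᵢ^{Jᵢ}`. -/
def unitPow (u : Fin n → (LaceFun k U)ˣ) (J : Fin n → ℤ) : (LaceFun k U)ˣ := ∏ i, u i ^ J i

lemma unitPow_add (u : Fin n → (LaceFun k U)ˣ) (I J : Fin n → ℤ) :
    unitPow u (I + J) = unitPow u I * unitPow u J := by
  simp [unitPow, zpow_add, Finset.prod_mul_distrib]

lemma unitPow_zero (u : Fin n → (LaceFun k U)ˣ) : unitPow u 0 = 1 := by simp [unitPow]

lemma unitPow_single_one (u : Fin n → (LaceFun k U)ˣ) (i : Fin n) :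
    unitPow u (Pi.single i 1) = u i := by
  rw [unitPow, Finset.prod_eq_single i]
  · simp
  · intro j _ hj; simp [hj]
  · simp

lemma unitNorm_eq_absMap (u : Fin n → (LaceFun k U)ˣ) (hr : r ∈ U.carrier) (i : Fin n) :
    unitNorm r hr (u i) = absMap u r i :=
  Subtype.ext ((deg_spec (u i)).gaussNorm_eq hr)

lemma gaussNorm_unitPow (u : Fin n → (LaceFun k U)ˣ) (hr : r ∈ U.carrier) (J : Fin n → ℤ) :
    gaussNorm r (unitPow u J : LaceFun k U) = mon (absMap u r) J := by
  rw [← val_unitNorm hr, unitPow, map_prod, mon]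
  simp_rw [map_zpow, unitNorm_eq_absMap]

/-- The product of the powers of the leading coefficients. -/
def leadPow (u : Fin n → (LaceFun k U)ˣ) (J : Fin n → ℤ) : kˣ := ∏ i, lead (u i) ^ J i

lemma norm_leadPow (u : Fin n → (LaceFun k U)ˣ) (J : Fin n → ℤ) :
    ‖(leadPow u J : k)‖ = mon (leadNorm u) J := by
  rw [val_mon, leadPow, Units.coe_prod, norm_prod]
  refine Finset.prod_congr rfl fun i _ => ?_
  rw [Units.val_zpow_eq_zpow_val, norm_zpow]
  rfl

variable (k U) in
/-- Invertible monomials form a group. -/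
def unitSingleHom : Multiplicative (Fin n → ℤ) × kˣ →* (LaceFun k U)ˣ :=
  MonoidHom.mk' (fun p => unitSingle U p.1.toAdd p.2) fun _ _ =>
    (unitSingle_mul _ _ _ _).symm

lemma unitPow_unitSingle (u : Fin n → (LaceFun k U)ˣ) (J : Fin n → ℤ) :
    ∏ i, unitSingle U (deg (u i)) (lead (u i)) ^ J i =
      unitSingle U (Matrix.vecMul J (degMatrix u)) (leadPow u J) := by
  have h : ∀ i, unitSingle U (deg (u i)) (lead (u i)) ^ J i =
      unitSingleHom k U ((Multiplicative.ofAdd (deg (u i)), lead (u i)) ^ J i) := fun i => by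
    rw [map_zpow]; rfl
  simp_rw [h]
  rw [← map_prod]
  change unitSingle U _ _ = _
  congr 1
  · rw [vecMul_eq_sum_smul, Prod.fst_prod, toAdd_prod]
    rfl
  · rw [Prod.snd_prod]
    rfl

/-- The units that are close to `1` for the norm `‖·‖_r`. -/
def nearOne (hr : r ∈ U.carrier) (ρ : ℝ) (hρ0 : 0 ≤ ρ) (hρ : ρ < 1) :
    Subgroup (LaceFun k U)ˣ where
  carrier := {w | gaussNorm r ((w : LaceFun k U) - 1) ≤ ρ}
  one_mem' := by simpa [gaussNorm_zero] using hρ0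
  mul_mem' := by
    intro v w hv hw
    have h1 : gaussNorm r (v : LaceFun k U) ≤ 1 := by
      have := gaussNorm_add_le ((v : LaceFun k U) - 1) 1 hr
      rw [sub_add_cancel, gaussNorm_one] at this
      exact this.trans (max_le (le_trans hv hρ.le) le_rfl)
    have e : ((v * w : (LaceFun k U)ˣ) : LaceFun k U) - 1 =
      (v : LaceFun k U) * ((w : LaceFun k U) - 1) + ((v : LaceFun k U) - 1) := by
      rw [Units.val_mul]; ring
    rw [Set.mem_ofPred_eq, e]
    refine (gaussNorm_add_le _ _ hr).trans (max_le ?_ hv)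
    rw [gaussNorm_mul _ _ hr]
    exact (mul_le_of_le_one_left (gaussNorm_nonneg _) h1).trans hw
  inv_mem' := by
    intro v hv
    have h1 : gaussNorm r (v : LaceFun k U) = 1 := by
      have := gaussNorm_add_eq_left (f := (1 : LaceFun k U)) (g := (v : LaceFun k U) - 1) hr
        (by rw [gaussNorm_one]; exact lt_of_le_of_lt hv hρ)
      rwa [add_sub_cancel, gaussNorm_one] at this
    have h2 := gaussNorm_mul (v : LaceFun k U) (((v⁻¹ : (LaceFun k U)ˣ) : LaceFun k U) - 1) hr
    rw [h1, one_mul, mul_sub, Units.mul_inv, mul_one, gaussNorm_sub_comm] at h2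
    rw [Set.mem_ofPred_eq, ← h2]
    exact hv

/-- One `ρ` works for all `J`: write each `u i` as its leading term times `w i`. The units within
`ρ` of `1` form a group (`nearOne`), so every `∏ w i ^ J i` lies in it, and the leading monomial of
`u^J` only scales the error. -/
lemma exists_gaussNorm_unitPow_sub_le (u : Fin n → (LaceFun k U)ˣ) (hr : r ∈ U.carrier) :
    ∃ ρ : ℝ, 0 ≤ ρ ∧ ρ < 1 ∧ ∀ J : Fin n → ℤ,
      gaussNorm r ((unitPow u J : LaceFun k U) -
        single (Matrix.vecMul J (degMatrix u)) (leadPow u J : k)) ≤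
          ρ * mon (absMap u r) J := by
  set w : Fin n → (LaceFun k U)ˣ := fun i => (unitSingle U (deg (u i)) (lead (u i)))⁻¹ * u i with hw
  have hlt : ∀ i, gaussNorm r ((w i : LaceFun k U) - 1) < 1 := fun i =>
    (deg_spec (u i)).gaussNorm_unitSingle_inv_mul_sub_one_lt (lead (u i)) rfl hr
  obtain ⟨ρ, hρ0, hρ, hwρ⟩ : ∃ ρ : ℝ, 0 ≤ ρ ∧ ρ < 1 ∧
      ∀ i, gaussNorm r ((w i : LaceFun k U) - 1) ≤ ρ := by
    rcases isEmpty_or_nonempty (Fin n) with h | h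
    · exact ⟨0, le_rfl, one_pos, fun i => isEmptyElim i⟩
    · obtain ⟨i, hi⟩ := Finite.exists_max fun i => gaussNorm r ((w i : LaceFun k U) - 1)
      exact ⟨_, gaussNorm_nonneg _, hlt i, hi⟩
  refine ⟨ρ, hρ0, hρ, fun J => ?_⟩
  set W : (LaceFun k U)ˣ := ∏ i, w i ^ J i with hWdef
  have hW : W ∈ nearOne (k := k) hr ρ hρ0 hρ :=
    Subgroup.prod_mem _ fun i _ => Subgroup.zpow_mem _ (hwρ i) _
  set G := unitSingle U (Matrix.vecMul J (degMatrix u)) (leadPow u J) with hG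
  have e : unitPow u J = G * W := by
    rw [hG, ← unitPow_unitSingle, hWdef, ← Finset.prod_mul_distrib, unitPow]
    refine Finset.prod_congr rfl fun i _ => ?_
    rw [← mul_zpow, hw, mul_inv_cancel_left]
  have e2 : (unitPow u J : LaceFun k U) - single (Matrix.vecMul J (degMatrix u)) (leadPow u J : k) =
      (G : LaceFun k U) * ((W : LaceFun k U) - 1) := by
    rw [e, hG, Units.val_mul, val_unitSingle]; ring
  rw [e2, gaussNorm_mul _ _ hr, hG, val_unitSingle, gaussNorm_single, norm_leadPow,
    ← Positive.val_mul, ← mon_monMap, mul_comm]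
  exact mul_le_mul_of_nonneg_right hW (mon_pos _ _).le

lemma gaussNorm_restrict (h : P.carrier ⊆ U.carrier) (f : LaceFun k U) :
    gaussNorm r (restrict h f) = gaussNorm r f := rfl

lemma coeff_restrict (h : P.carrier ⊆ U.carrier) (f : LaceFun k U) (I) :
    (restrict h f).coeff I = f.coeff I := rfl

/-- Bounded additive maps are controlled by their values on the monomials. -/
lemma gaussNorm_map_le_of_single (T : LaceFun k Q →+ LaceFun k P) {s : Fin n → PosReal}
    (hr : r ∈ P.carrier) (hs : s ∈ Q.carrier) {C ρ : ℝ} (hρ : 0 ≤ ρ)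
    (hC : ∀ f, gaussNorm r (T f) ≤ C * gaussNorm s f)
    (h : ∀ J c, gaussNorm r (T (single J c)) ≤ ρ * (‖c‖ * mon s J)) (f : LaceFun k Q) :
    gaussNorm r (T f) ≤ ρ * gaussNorm s f := by
  have hlim : Tendsto (fun F => C * gaussNorm s (f - ofLaurent k Q (f.partialSum F)) +
      ρ * gaussNorm s f) atTop (𝓝 (C * 0 + ρ * gaussNorm s f)) :=
    ((f.tendsto_gaussNorm_sub_partialSum hs).const_mul C).add_const _
  rw [mul_zero, zero_add] at hlim
  -- The crude bound `C` multiplies only the tail of `f`, so it disappears in the limit.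
  refine ge_of_tendsto' hlim fun F => ?_
  have h0 := mul_nonneg hρ (gaussNorm_nonneg (r := s) f)
  have e : T f = T (f - ofLaurent k Q (f.partialSum F)) + T (ofLaurent k Q (f.partialSum F)) := by
    rw [← map_add, sub_add_cancel]
  rw [e]
  refine (gaussNorm_add_le _ _ hr).trans ((max_le_add_of_nonneg (gaussNorm_nonneg _)
    (gaussNorm_nonneg _)).trans (add_le_add (hC _) ?_))
  rw [ofLaurent_partialSum, map_sum]
  refine gaussNorm_sum_le _ _ hr h0 fun J _ => (h J _).trans ?_
  exact mul_le_mul_of_nonneg_left (f.le_gaussNorm hs J) hρ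

section Subst

variable (u : Fin n → (LaceFun k U)ˣ) (hP : P.carrier ⊆ U.carrier)
  (hPQ : ∀ r ∈ P.carrier, absMap u r ∈ Q.carrier)

include hPQ in
lemma tendsto_gaussNorm_smul_unitPow (g : LaceFun k Q) : ∀ r ∈ P.carrier,
    Tendsto (fun J => gaussNorm r (g.coeff J • restrict hP (unitPow u J : LaceFun k U)))
      cofinite (𝓝 0) := by
  intro r hr
  refine (g.tendsto (hPQ r hr)).congr fun J => ?_
  rw [gaussNorm_smul, gaussNorm_restrict, gaussNorm_unitPow u (hP hr)]

/-- Substitution as a linear map `A_Q → A_P`, `∑ g_J T^J ↦ ∑ g_J u^J`. -/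
def substLin : LaceFun k Q →ₗ[k] LaceFun k P where
  toFun g := lsum (fun J => g.coeff J • restrict hP (unitPow u J : LaceFun k U))
    (tendsto_gaussNorm_smul_unitPow u hP hPQ g)
  map_add' f g := by
    ext I
    rw [coeff_add, coeff_lsum, coeff_lsum, coeff_lsum,
      ← (summable_coeff (tendsto_gaussNorm_smul_unitPow u hP hPQ f) I).tsum_add
        (summable_coeff (tendsto_gaussNorm_smul_unitPow u hP hPQ g) I)]
    exact tsum_congr fun J => by rw [coeff_add, add_smul, coeff_add]
  map_smul' c g := by
    ext I
    rw [RingHom.id_apply, coeff_smul, coeff_lsum, coeff_lsum,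
      ← (summable_coeff (tendsto_gaussNorm_smul_unitPow u hP hPQ g) I).tsum_mul_left]
    exact tsum_congr fun J => by simp only [coeff_smul, mul_assoc]

lemma coeff_substLin (g : LaceFun k Q) (I) : (substLin u hP hPQ g).coeff I =
    ∑' J, g.coeff J * (unitPow u J : LaceFun k U).coeff I := rfl

lemma gaussNorm_substLin_le (hr : r ∈ P.carrier) (g : LaceFun k Q) :
    gaussNorm r (substLin u hP hPQ g) ≤ gaussNorm (absMap u r) g := by
  refine gaussNorm_lsum_le _ (tendsto_gaussNorm_smul_unitPow u hP hPQ g) hr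
    (gaussNorm_nonneg _) fun J => ?_
  rw [gaussNorm_smul, gaussNorm_restrict, gaussNorm_unitPow u (hP hr)]
  exact g.le_gaussNorm (hPQ r hr) J

lemma substLin_single (J : Fin n → ℤ) (c : k) : substLin u hP hPQ (single J c) =
    c • restrict hP (unitPow u J : LaceFun k U) := by
  ext I
  rw [coeff_substLin, tsum_eq_single J fun L hL => by rw [coeff_single_ne hL, zero_mul],
    coeff_single_same, coeff_smul, coeff_restrict]

/-- The defect of multiplicativity `B` is biadditive, symmetric, bounded, and zero on pairs of
monomials. Applying `gaussNorm_map_le_of_single` with `ρ = 0` in each variable shows that it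
vanishes. -/
lemma substLin_mul (f g : LaceFun k Q) :
    substLin u hP hPQ (f * g) = substLin u hP hPQ f * substLin u hP hPQ g := by
  obtain ⟨r, hr⟩ := P.isConnected.nonempty
  have hs := hPQ r hr
  let B (f : LaceFun k Q) : LaceFun k Q →+ LaceFun k P :=
    (substLin u hP hPQ).toAddMonoidHom.comp (AddMonoidHom.mulLeft f) -
      (AddMonoidHom.mulLeft (substLin u hP hPQ f)).comp (substLin u hP hPQ).toAddMonoidHom
  have hB : ∀ f g, B f g = substLin u hP hPQ (f * g) - substLin u hP hPQ f * substLin u hP hPQ g :=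
    fun _ _ => rfl
  have hsymm : ∀ f g, B f g = B g f := fun f g => by
    rw [hB, hB, mul_comm f, mul_comm (_ : LaceFun k P)]
  have hbound : ∀ f g, gaussNorm r (B f g) ≤
      gaussNorm (absMap u r) f * gaussNorm (absMap u r) g := by
    intro f g
    rw [hB]
    refine (gaussNorm_sub_le _ _ hr).trans (max_le ?_ ?_)
    · rw [← gaussNorm_mul _ _ hs]
      exact gaussNorm_substLin_le u hP hPQ hr _
    · rw [gaussNorm_mul _ _ hr]
      exact mul_le_mul (gaussNorm_substLin_le u hP hPQ hr _) (gaussNorm_substLin_le u hP hPQ hr _)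
        (gaussNorm_nonneg _) (gaussNorm_nonneg _)
  have hext : ∀ f, (∀ J c, B f (single J c) = 0) → ∀ g, B f g = 0 := by
    intro f hf g
    have h := gaussNorm_map_le_of_single (B f) hr hs le_rfl (hbound f)
      (fun J c => by rw [hf, gaussNorm_zero, zero_mul]) g
    rw [zero_mul] at h
    exact (gaussNorm_eq_zero hr).1 (h.antisymm (gaussNorm_nonneg _))
  have hmono : ∀ I J (c d : k), B (single I c) (single J d) = 0 := by
    intro I J c d
    rw [hB, single_mul_single, substLin_single, substLin_single, substLin_single, unitPow_add,
      Units.val_mul, map_mul, smul_mul_smul_comm, sub_self]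
  have hall : ∀ f g, B f g = 0 := fun f g => hext f (fun J c => by
    rw [hsymm]; exact hext _ (fun I d => hmono _ _ _ _) f) g
  exact sub_eq_zero.1 (hall f g)

/-- Substitution as a morphism of algebras `A_Q → A_P`. -/
def subst : LaceFun k Q →ₐ[k] LaceFun k P :=
  AlgHom.ofLinearMap (substLin u hP hPQ)
    (by rw [one_def, substLin_single, unitPow_zero, Units.val_one, map_one, one_smul])
    (substLin_mul u hP hPQ)

lemma subst_single (J : Fin n → ℤ) (c : k) : subst u hP hPQ (single J c) =
    c • restrict hP (unitPow u J : LaceFun k U) := substLin_single u hP hPQ J c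

lemma gaussNorm_subst_le (hr : r ∈ P.carrier) (g : LaceFun k Q) :
    gaussNorm r (subst u hP hPQ g) ≤ gaussNorm (absMap u r) g :=
  gaussNorm_substLin_le u hP hPQ hr g

end Subst

/-! ### Bijectivity of the substitution when the degree matrix is invertible. -/

section Bijective

variable (u : Fin n → (LaceFun k U)ˣ) (hP : P.carrier ⊆ U.carrier)
  (hPQ : ∀ r ∈ P.carrier, absMap u r ∈ Q.carrier) (hM : IsUnit (degMatrix u))
  (hQP : ∀ s ∈ Q.carrier, ∃ r ∈ P.carrier, absMap u r = s)

/-- The size of each term is preserved under the reindexing `J ↦ J · degMatrix u`; this makes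
`retract` an isometry. -/
lemma term_retract (h : LaceFun k P) (r) (J : Fin n → ℤ) :
    ‖((leadPow u J)⁻¹ : kˣ) * h.coeff (Matrix.vecMul J (degMatrix u))‖ * (mon (absMap u r) J : ℝ) =
      ‖h.coeff (Matrix.vecMul J (degMatrix u))‖ * mon r (Matrix.vecMul J (degMatrix u)) := by
  have h0 := (mon_pos (leadNorm u) J).ne'
  rw [absMap, mon_monMap, Positive.val_mul, norm_mul, Units.val_inv_eq_inv_val, norm_inv,
    norm_leadPow]
  field_simp

/-- The left inverse of the substitution of the leading monomials of `u`. -/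
def retract : LaceFun k P →+ LaceFun k Q where
  toFun h := ⟨fun J => ((leadPow u J)⁻¹ : kˣ) * h.coeff (Matrix.vecMul J (degMatrix u)), by
    intro s hs
    obtain ⟨r, hr, rfl⟩ := hQP s hs
    exact ((h.tendsto hr).comp
      (Matrix.vecMul_injective_of_isUnit hM).tendsto_cofinite).congr fun J =>
        (term_retract u h r J).symm⟩
  map_zero' := by
    ext J
    exact mul_zero _
  map_add' f g := by
    ext J
    exact mul_add _ _ _

lemma coeff_retract (h : LaceFun k P) (J) : (retract u hM hQP h).coeff J =
    ((leadPow u J)⁻¹ : kˣ) * h.coeff (Matrix.vecMul J (degMatrix u)) := rfl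

lemma gaussNorm_retract (h : LaceFun k P) :
    gaussNorm (absMap u r) (retract u hM hQP h) = gaussNorm r h := by
  rw [gaussNorm, gaussNorm]
  simp_rw [coeff_retract, term_retract]
  exact (Matrix.vecMul_surjective_iff_isUnit.2 hM).iSup_comp fun I => ‖h.coeff I‖ * (mon r I : ℝ)

/-- `retract` undoes the substitution of leading monomials exactly, so on `T^J` only the difference
between `u^J` and its leading monomial remains. Boundedness extends the estimate to all `g`. -/
lemma gaussNorm_retract_subst_sub_le (hr : r ∈ P.carrier) {ρ : ℝ} (hρ0 : 0 ≤ ρ)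
    (hρ : ∀ J : Fin n → ℤ, gaussNorm r ((unitPow u J : LaceFun k U) -
        single (Matrix.vecMul J (degMatrix u)) (leadPow u J : k)) ≤ ρ * mon (absMap u r) J)
    (g : LaceFun k Q) :
    gaussNorm (absMap u r) (retract u hM hQP (subst u hP hPQ g) - g) ≤
      ρ * gaussNorm (absMap u r) g := by
  have hs := hPQ r hr
  refine gaussNorm_map_le_of_single (C := 1) ((retract u hM hQP).comp
    (subst u hP hPQ).toLinearMap.toAddMonoidHom - AddMonoidHom.id _) hs hs hρ0
    (fun f => ?_) (fun J c => ?_) g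
  · change gaussNorm _ (retract u hM hQP (subst u hP hPQ f) - f) ≤ _
    rw [one_mul]
    refine (gaussNorm_sub_le _ _ hs).trans (max_le ?_ le_rfl)
    rw [gaussNorm_retract]
    exact gaussNorm_subst_le u hP hPQ hr f
  · change gaussNorm _ (retract u hM hQP (subst u hP hPQ (single J c)) - single J c) ≤ _
    have e : (single J c : LaceFun k Q) = retract u hM hQP
        (c • restrict hP (single (Matrix.vecMul J (degMatrix u)) (leadPow u J : k))) := by
      ext L
      rw [coeff_retract, coeff_smul, coeff_restrict]
      by_cases hL : L = J
      · subst hL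
        rw [coeff_single_same, coeff_single_same, mul_left_comm, Units.inv_mul, mul_one]
      · rw [coeff_single_ne hL, coeff_single_ne
          fun h => hL (Matrix.vecMul_injective_of_isUnit hM h), mul_zero, mul_zero]
    rw [subst_single, e, ← map_sub, ← smul_sub, ← map_sub, gaussNorm_retract, gaussNorm_smul,
      gaussNorm_restrict, mul_left_comm]
    exact mul_le_mul_of_nonneg_left (hρ J) (norm_nonneg c)

include hM hQP in
lemma gaussNorm_subst (hr : r ∈ P.carrier) (g : LaceFun k Q) :
    gaussNorm r (subst u hP hPQ g) = gaussNorm (absMap u r) g := by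
  by_cases hg : g = 0
  · rw [hg, map_zero, gaussNorm_zero, gaussNorm_zero]
  have hs := hPQ r hr
  obtain ⟨ρ, hρ0, hρ1, hρ⟩ := exists_gaussNorm_unitPow_sub_le u (hP hr)
  have h1 := gaussNorm_retract_subst_sub_le u hP hPQ hM hQP hr hρ0 hρ g
  have h2 := gaussNorm_add_eq_left hs
    (h1.trans_lt (mul_lt_of_lt_one_left (gaussNorm_pos hs hg) hρ1))
  rwa [add_sub_cancel, gaussNorm_retract] at h2

include hM hQP in
-- `retract ∘ subst` is a contraction away from the identity, hence bijective; as `retract` is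
-- injective, `subst` is bijective.
lemma bijective_subst : Function.Bijective (subst u hP hPQ) := by
  have hcomp : Function.Bijective ((retract u hM hQP).comp
      (subst u hP hPQ).toLinearMap.toAddMonoidHom) := by
    refine bijective_of_contraction _ fun s hs => ?_
    obtain ⟨r, hr, rfl⟩ := hQP s hs
    obtain ⟨ρ, hρ0, hρ1, hρ⟩ := exists_gaussNorm_unitPow_sub_le u (hP hr)
    exact ⟨ρ, hρ0, hρ1, fun g => gaussNorm_retract_subst_sub_le u hP hPQ hM hQP hr hρ0 hρ g⟩
  have hinj : Function.Injective (retract (P := P) u hM hQP) := by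
    rw [injective_iff_map_eq_zero]
    intro h h0
    obtain ⟨r, hr⟩ := P.isConnected.nonempty
    rw [← gaussNorm_eq_zero hr, ← gaussNorm_retract u hM hQP, h0, gaussNorm_zero]
  refine ⟨fun f g hfg => hcomp.1 (congrArg (retract u hM hQP) hfg), fun y => ?_⟩
  obtain ⟨g, hg⟩ := hcomp.2 (retract u hM hQP y)
  exact ⟨g, hinj hg⟩

end Bijective

end LaceFun

end Dentelle

namespace Dentelle

open LaceFun

variable {k : Type*} [NormedField k] [IsUltrametricDist k] [CompleteSpace k] {n : ℕ}
  {U V : LaceType n}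

/-! ### The map on points induced by a bounded morphism of algebras -/

/-- The image of a point under the map induced by a bounded morphism of algebras. -/
def pointOf (S : LaceFun k V →ₐ[k] LaceFun k U) (x : TorusPoint k n) (hx : x ∈ domain k U) :
    TorusPoint k n where
  val := (absVal x hx).comap (S.comp (ofLaurent k V)).toRingHom
  val_const c := by
    have h1 : ofLaurent k V (AddMonoidAlgebra.single 0 c) = algebraMap k _ c := by
      rw [ofLaurent_single, Algebra.algebraMap_eq_smul_one, one_def, smul_single, mul_one]
    have h2 : ofLaurent k U (AddMonoidAlgebra.single 0 c) = algebraMap k _ c := by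
      rw [ofLaurent_single, Algebra.algebraMap_eq_smul_one, one_def, smul_single, mul_one]
    change (S (ofLaurent k V (AddMonoidAlgebra.single 0 c))).absAt x = _
    rw [h1, AlgHom.commutes, ← h2, absAt_ofLaurent _ hx, x.val_const]

lemma val_pointOf (S : LaceFun k V →ₐ[k] LaceFun k U) {x : TorusPoint k n} (hx : x ∈ domain k U)
    (p : LaurentPoly k n) : (pointOf S x hx).val p = (S (ofLaurent k V p)).absAt x := rfl

lemma radius_pointOf (S : LaceFun k V →ₐ[k] LaceFun k U) {x : TorusPoint k n}
    (hx : x ∈ domain k U) {s : Fin n → PosReal}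
    (hS : ∀ g, gaussNorm x.radius (S g) ≤ gaussNorm s g) : (pointOf S x hx).radius = s := by
  refine TorusPoint.radius_eq_of_val_monomialT_le _ fun I => ?_
  rw [val_pointOf]
  refine (absAt_le _ hx).trans ((hS _).trans ?_)
  rw [monomialT, ofLaurent_single, gaussNorm_single, norm_one, one_mul]

/-- The point is defined through Laurent polynomials alone; the bound on `S` extends the formula to
convergent series. -/
lemma absAt_pointOf (S : LaceFun k V →ₐ[k] LaceFun k U) {x : TorusPoint k n}
    (hx : x ∈ domain k U) {s : Fin n → PosReal} (hs : s ∈ V.carrier)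
    (hS : ∀ g, gaussNorm x.radius (S g) ≤ gaussNorm s g) (g : LaceFun k V) :
    g.absAt (pointOf S x hx) = (S g).absAt x := by
  have hrad := radius_pointOf S hx hS
  have hmem : pointOf S x hx ∈ domain k V := by
    rwa [mem_domain, hrad]
  refine tendsto_nhds_unique (g.tendsto_absAt hmem) ?_
  simp_rw [val_pointOf]
  rw [← NNReal.tendsto_coe, tendsto_iff_dist_tendsto_zero]
  refine squeeze_zero (fun _ => dist_nonneg) (fun F => ?_) (g.tendsto_gaussNorm_sub_partialSum hs)
  have h1 : ((S (g - ofLaurent k V (g.partialSum F))).absAt x : ℝ) ≤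
      gaussNorm s (g - ofLaurent k V (g.partialSum F)) := (absAt_le _ hx).trans (hS _)
  have h2 := (absVal x hx).map_add (S (g - ofLaurent k V (g.partialSum F)))
    (S (ofLaurent k V (g.partialSum F)))
  have h3 := (absVal x hx).map_sub (S g) (S (g - ofLaurent k V (g.partialSum F)))
  rw [← map_add, sub_add_cancel] at h2
  rw [← map_sub, sub_sub_cancel] at h3
  have h2' := NNReal.coe_le_coe.2 (h2.trans (max_le_add_of_nonneg zero_le zero_le))
  have h3' := NNReal.coe_le_coe.2 (h3.trans (max_le_add_of_nonneg zero_le zero_le))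
  simp only [absVal_apply, NNReal.coe_add] at h2' h3'
  rw [Real.dist_eq, abs_sub_le_iff]
  constructor <;> linarith

/-- The continuous map `D_U → D_V` induced by a bounded morphism of algebras `A_V → A_U`. -/
def pointMap (S : LaceFun k V →ₐ[k] LaceFun k U) (m : (Fin n → PosReal) → Fin n → PosReal)
    (hm : ∀ r ∈ U.carrier, m r ∈ V.carrier)
    (hS : ∀ r ∈ U.carrier, ∀ g, gaussNorm r (S g) ≤ gaussNorm (m r) g) (x : domain k U) :
    domain k V :=
  ⟨pointOf S x.1 x.2, by
    rw [mem_domain, radius_pointOf S x.2 (hS _ x.2)]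
    exact hm _ x.2⟩

lemma continuous_pointMap (S : LaceFun k V →ₐ[k] LaceFun k U)
    (m : (Fin n → PosReal) → Fin n → PosReal) (hm) (hS) : Continuous (pointMap S m hm hS) :=
  continuous_induced_rng.2 <| continuous_induced_rng.2 <| continuous_pi fun p =>
    continuous_absAt (S (ofLaurent k V p))

lemma pointMap_pointMap {S : LaceFun k V →ₐ[k] LaceFun k U} {S' : LaceFun k U →ₐ[k] LaceFun k V}
    {m m' : (Fin n → PosReal) → Fin n → PosReal} (hm hm' hS hS')
    (h : ∀ g, S (S' g) = g) (x : domain k U) :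
    pointMap S' m' hm' hS' (pointMap S m hm hS x) = x := by
  refine Subtype.ext (TorusPoint.ext_val fun p => ?_)
  change (S' (ofLaurent k U p)).absAt (pointOf S x.1 x.2) = _
  rw [absAt_pointOf S x.2 (hm _ x.2) (hS _ x.2), h, absAt_ofLaurent _ x.2]

/-! ### Units with invertible degree matrix form a coordinate system -/

lemma restrict_ofLaurent {P U : LaceType n} (h : P.carrier ⊆ U.carrier) (p : LaurentPoly k n) :
    restrict h (ofLaurent k U p) = ofLaurent k P p := by
  induction p using AddMonoidAlgebra.induction_on with
  | of I =>
    rw [AddMonoidAlgebra.of_apply, ofLaurent_single, ofLaurent_single]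
    rfl
  | add p q hp hq => simp only [map_add, hp, hq]
  | smul c p hp => simp only [map_smul, hp]

lemma isCoordinateSystem_of_isUnit_degMatrix (u : Fin n → (LaceFun k U)ˣ)
    (hM : IsUnit (degMatrix u)) : IsCoordinateSystem fun i => (u i : LaceFun k U) := by
  let V : LaceType n := U.map (leadNorm u) hM.unit
  have hinj : Function.Injective (absMap u) := (monHomeo (leadNorm u) hM.unit).injective
  have hm : ∀ r ∈ U.carrier, absMap u r ∈ V.carrier := fun r hr => ⟨r, hr, rfl⟩
  have hV : ∀ s ∈ V.carrier, ∃ r ∈ U.carrier, absMap u r = s := fun s hs => hs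
  let S : LaceFun k V →ₐ[k] LaceFun k U := subst u subset_rfl hm
  have hS : ∀ r ∈ U.carrier, ∀ g, gaussNorm r (S g) ≤ gaussNorm (absMap u r) g :=
    fun r hr g => gaussNorm_subst_le u subset_rfl hm hr g
  let e : LaceFun k V ≃ₐ[k] LaceFun k U :=
    AlgEquiv.ofBijective S (bijective_subst u subset_rfl hm hM hV)
  have hm' : ∀ s ∈ V.carrier, (monHomeo (leadNorm u) hM.unit).symm s ∈ U.carrier := by
    rintro _ ⟨r, hr, rfl⟩
    rwa [Homeomorph.symm_apply_apply]
  -- As `S` is isometric, its inverse is bounded too and induces the inverse map on points.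
  have hS' : ∀ s ∈ V.carrier, ∀ g, gaussNorm s ((e.symm : LaceFun k U →ₐ[k] LaceFun k V) g) ≤
      gaussNorm ((monHomeo (leadNorm u) hM.unit).symm s) g := by
    rintro _ ⟨r, hr, rfl⟩ g
    rw [Homeomorph.symm_apply_apply]
    refine (gaussNorm_subst u subset_rfl hm hM hV hr (e.symm g)).ge.trans (le_of_eq ?_)
    exact congrArg (gaussNorm r) (e.apply_symm_apply g)
  have hrad : ∀ x : domain k U, (pointMap S (absMap u) hm hS x).1.radius = absMap u x.1.radius :=
    fun x => radius_pointOf S x.2 (hS _ x.2)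
  -- Every `r ∈ P` is the radius of a Gauss point, so the inclusion between domains descends to
  -- their types.
  have hPQ : ∀ P Q : LaceType n, P.carrier ⊆ U.carrier →
      (∀ x : domain k U, x.1 ∈ domain k P → (pointMap S (absMap u) hm hS x).1 ∈ domain k Q) →
      ∀ r ∈ P.carrier, absMap u r ∈ Q.carrier := by
    intro P Q hP h r hr
    have := h ⟨gaussPoint k r (hP hr), gaussPoint_mem (hP hr)⟩
      (by rwa [mem_domain, radius_gaussPoint])
    rwa [mem_domain, hrad, radius_gaussPoint] at this
  let φ : LaceHom k U V :=
    { toFun := pointMap S (absMap u) hm hS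
      continuous_toFun := continuous_pointMap S _ hm hS
      pullback := fun P Q hP _ h => subst u hP (hPQ P Q hP h)
      pullback_restrict := fun P Q P' Q' hP hQ h hP' hQ' h' hPP hQQ g => rfl
      absAt_pullback := by
        intro P Q hP hQ h g x hx
        rw [← absAt_pointOf (subst u hP (hPQ P Q hP h)) hx (hPQ P Q hP h _ hx)
          (gaussNorm_subst_le u hP (hPQ P Q hP h) hx)]
        congr 1
        -- The image point computed from `P` agrees with the one computed from `U`, because both
        -- substitutions use the same series on Laurent polynomials.
        refine TorusPoint.ext_val fun p => ?_
        change _ = (S (ofLaurent k V p)).absAt x.1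
        rw [val_pointOf, ← restrict_ofLaurent hQ]
        rfl }
  refine ⟨V, φ, ⟨?_, ?_⟩, fun i => ?_⟩
  · let H : domain k U ≃ₜ domain k V :=
      { toFun := pointMap S (absMap u) hm hS
        invFun := pointMap _ _ hm' hS'
        left_inv := pointMap_pointMap hm hm' hS hS' e.apply_symm_apply
        right_inv := pointMap_pointMap hm' hm hS' hS e.symm_apply_apply
        continuous_toFun := continuous_pointMap _ _ _ _
        continuous_invFun := continuous_pointMap _ _ _ _ }
    exact H.isHomeomorph
  · intro P Q hP hQ h
    refine bijective_subst u hP (hPQ P Q hP fun x => (h x).1) hM fun s hs => ?_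
    obtain ⟨r, hr, rfl⟩ := hV s (hQ hs)
    refine ⟨r, ?_, rfl⟩
    have := (h ⟨gaussPoint k r hr, gaussPoint_mem hr⟩).2 (by
      change (pointMap S (absMap u) hm hS ⟨gaussPoint k r hr, gaussPoint_mem hr⟩).1 ∈ _
      rwa [mem_domain, hrad, radius_gaussPoint])
    rwa [mem_domain, radius_gaussPoint] at this
  · change subst u subset_rfl _ (single (Pi.single i 1) 1) = _
    rw [subst_single, unitPow_single_one, one_smul]
    rfl

lemma isCoordinateSystem_iff (f : Fin n → LaceFun k U) : IsCoordinateSystem f ↔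
    ∃ M : Matrix.GeneralLinearGroup (Fin n) ℤ,
      ∀ i, (f i).HasStrictlyDominantMonomial ((M : Matrix (Fin n) (Fin n) ℤ) i) := by
  refine ⟨IsCoordinateSystem.exists_generalLinearGroup, ?_⟩
  rintro ⟨M, hM⟩
  have hunit : ∀ i, IsUnit (f i) := fun i => (hM i).isUnit ((hM i).coeff_ne_zero i)
  have hdeg : degMatrix (fun i => (hunit i).unit) = M :=
    funext fun i => HasStrictlyDominantMonomial.deg_eq (hM i)
  exact isCoordinateSystem_of_isUnit_degMatrix (fun i => (hunit i).unit) (hdeg ▸ M.isUnit)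

end Dentelle

end

theorem mainTheorem8 {k : Type*} [NormedField k] [IsUltrametricDist k] [CompleteSpace k] {n : ℕ}
    (U : Dentelle.LaceType n) :
    (∀ f : Fin n → Dentelle.LaceFun k U,
      Dentelle.IsCoordinateSystem f ↔
        ∃ M : Matrix.GeneralLinearGroup (Fin n) ℤ,
          ∀ i, (f i).HasStrictlyDominantMonomial ((M : Matrix (Fin n) (Fin n) ℤ) i)) ∧
    (Module.Free ℤ (Dentelle.Lattice k U) ∧ Module.rank ℤ (Dentelle.Lattice k U) = n) ∧
    (∀ f : Fin n → Dentelle.LaceFun k U,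
      Dentelle.IsCoordinateSystem f ↔
        ∃ (u : Fin n → (Dentelle.LaceFun k U)ˣ)
          (b : Module.Basis (Fin n) ℤ (Dentelle.Lattice k U)),
          ∀ i, (u i : Dentelle.LaceFun k U) = f i ∧ b i = Dentelle.Lattice.mk (u i)) := by
  refine ⟨Dentelle.isCoordinateSystem_iff, ⟨Module.Free.of_basis (Dentelle.latticeBasis U), ?_⟩,
    fun f => (Dentelle.isCoordinateSystem_iff f).trans (Dentelle.exists_basis_iff f)⟩
  rw [rank_eq_card_basis (Dentelle.latticeBasis U), Fintype.card_fin]
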